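/- Let $N\ge 1$. All C*-algebras are unital. A closed subspace $X$ of the free real sphere $S^{N-1}_{\mathbb R,+}$ is a C*-algebra $C(X)$ generated by self-adjoint coordinates $x_1,\dots,x_N$ with $\sum_i x_i^2=1$. A closed subspace $G$ of the free orthogonal quantum group $O_N^+$ is a C*-algebra $C(G)$ generated by the entries of a matrix $u=(u_{ij})\in M_N(C(G))$ with $u_{ij}=u_{ij}^*$ and $uu^t=u^tu=1$. In both cases, an inclusion of subspaces is a unital $*$-homomorphism, in the opposite direction, which maps coordinates to coordinates. All tensor products of C*-algebras below are maximal. We call $G\subset O_N^+$ a compact quantum group if there are unital $*$-homomorphisms $\Delta:C(G)\to C(G)\otimes C(G)$, $\varepsilon:C(G)\to\mathbb C$, $S:C(G)\to C(G)^{opp}$ with $\Delta(u_{ij})=\sum_k u_{ik}\otimes u_{kj}$, $\varepsilon(u_{ij})=\delta_{ij}$, $S(u_{ij})=u_{ji}$. It acts affinely on $X$ if there is a unital $*$-homomorphism $\Phi:C(X)\to C(G)\otimes C(X)$ with $\Phi(x_i)=\sum_j u_{ij}\otimes x_j$. The quantum affine isometry group $G^+(X)$ is the largest compact quantum group $G\subset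 O_N^+$ acting affinely on $X$. For a group $\Gamma=\langle g_1,\dots,g_N\rangle$ with $g_i^2=1$, the noncommutative cube $\widehat\Gamma$ is given by the full group C*-algebra $C(\widehat\Gamma)=C^*(\Gamma)$, with coordinates $x_i=g_i/\sqrt N$. Let $\mathbb Z_2^{*N}$ be the free product of $N$ copies of $\mathbb Z_2$, and let $\mathbb Z_2^{\circ N}$ be its quotient by the relations $abc=cba$ between the standard generators. Let $\bar O_N$, $H_N^+$, $H_N^*$ be the closed subspaces of $O_N^+$ which are universal for the following relations. For $\bar O_N$: $ab=-ba$ for entries $a\ne b$ of $u$ on the same row or column, and $ab=ba$ for all the other pairs of entries. For $H_N^+$: $ab=0$ for entries $a\neq b$ on the same row or column. For $H_N^*$: the relations of $H_N^+$, together with $abc=cba$ for all the entries $a,b,c$ of $u$. **Theorem.** The quantum affine isometry groups of $\widehat{\mathbb Z_2^N}$, $\widehat{\mathbb Z_2^{\circ N}}$, $\widehat{\mathbb Z_2^{*N}}$ exist, and $$G^+(\widehat{\mathbb Z_2^N})=\bar O_N,\qquad G^+(\widehat{\mathbb Z_2^{\circ N}})=H_N^*,\qquad G^+(\widehat{\mathbb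 Z_2^{*N}})=H_N^+ .$$ Moreover $\widehat{\mathbb Z_2^N}\subset\widehat{\mathbb Z_2^{\circ N}}\subset\widehat{\mathbb Z_2^{*N}}$ and $H_N^*\subset H_N^+$, while for $N\ge2$ neither of $\bar O_N$, $H_N^*$ is included in the other, as subspaces of $O_N^+$. -/

import Mathlib

universe u v

open scoped TensorProduct

noncomputable section

namespace NCCube

/-! ### C*-seminorms and the associated C*-algebras -/

/-- A C*-seminorm on a complex unital *-algebra. -/
structure CStarSeminorm (A : Type u) [Ring A] [StarRing A] [Algebra ℂ A] extends
    Seminorm ℂ A where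
  mul_le' : ∀ a b : A, toFun (a * b) ≤ toFun a * toFun b
  star_mul_self' : ∀ a : A, toFun (star a * a) = toFun a * toFun a

namespace CStarSeminorm

variable {A : Type u} [Ring A] [StarRing A] [Algebra ℂ A]

instance : CoeFun (CStarSeminorm A) (fun _ => A → ℝ) := ⟨fun p => p.toSeminorm⟩

theorem nonneg (p : CStarSeminorm A) (a : A) : 0 ≤ p a := apply_nonneg p.toSeminorm a

theorem mul_le (p : CStarSeminorm A) (a b : A) : p (a * b) ≤ p a * p b := p.mul_le' a b

theorem star_mul_self (p : CStarSeminorm A) (a : A) : p (star a * a) = p a * p a :=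
  p.star_mul_self' a

theorem le_star (p : CStarSeminorm A) (a : A) : p a ≤ p (star a) := by
  rcases (p.nonneg a).eq_or_lt with h | h
  · rw [← h]; exact p.nonneg _
  · have h1 := p.mul_le (star a) a
    rw [p.star_mul_self] at h1
    exact le_of_mul_le_mul_right h1 h

theorem star_eq (p : CStarSeminorm A) (a : A) : p (star a) = p a :=
  le_antisymm (by simpa using p.le_star (star a)) (p.le_star a)

theorem one_le (p : CStarSeminorm A) : p 1 ≤ 1 := by
  have h := p.star_mul_self 1
  simp only [star_one, mul_one] at h
  nlinarith [p.nonneg 1]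

/-- The pointwise supremum of a pointwise bounded family of C*-seminorms. -/
def sup (F : Set (CStarSeminorm A)) (hF : ∀ a, BddAbove (Set.range fun p : F => p.1 a)) :
    CStarSeminorm A where
  toSeminorm := Seminorm.of (fun a => ⨆ p : F, p.1 a)
    (fun a b => Real.iSup_le
      (fun p => (map_add_le_add p.1.toSeminorm a b).trans
        (add_le_add (le_ciSup (hF a) p) (le_ciSup (hF b) p)))
      (add_nonneg (Real.iSup_nonneg fun p => p.1.nonneg a)
        (Real.iSup_nonneg fun p => p.1.nonneg b)))
    (fun c a => by
      rw [Real.mul_iSup_of_nonneg (norm_nonneg c)]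
      exact congrArg _ (funext fun p => map_smul_eq_mul p.1.toSeminorm c a))
  mul_le' a b := Real.iSup_le
    (fun p => (p.1.mul_le a b).trans
      (mul_le_mul (le_ciSup (hF a) p) (le_ciSup (hF b) p) (p.1.nonneg b)
        (Real.iSup_nonneg fun p => p.1.nonneg a)))
    (mul_nonneg (Real.iSup_nonneg fun p => p.1.nonneg a)
        (Real.iSup_nonneg fun p => p.1.nonneg b))
  star_mul_self' a := by
    change (⨆ p : F, p.1 (star a * a)) = (⨆ p : F, p.1 a) * (⨆ p : F, p.1 a)
    have h0 : 0 ≤ ⨆ p : F, p.1 a := Real.iSup_nonneg fun p => p.1.nonneg a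
    apply le_antisymm
    · refine Real.iSup_le (fun p => ?_) (mul_nonneg h0 h0)
      rw [p.1.star_mul_self]
      exact mul_le_mul (le_ciSup (hF a) p) (le_ciSup (hF a) p) (p.1.nonneg a) h0
    · have h1 : 0 ≤ ⨆ p : F, p.1 (star a * a) := Real.iSup_nonneg fun p => p.1.nonneg _
      have h2 : (⨆ p : F, p.1 a) ≤ √(⨆ p : F, p.1 (star a * a)) := by
        refine Real.iSup_le (fun p => Real.le_sqrt_of_sq_le ?_) (Real.sqrt_nonneg _)
        rw [sq, ← p.1.star_mul_self]
        exact le_ciSup (hF (star a * a)) p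
      calc _ ≤ √(⨆ p : F, p.1 (star a * a)) * √(⨆ p : F, p.1 (star a * a)) :=
            mul_le_mul h2 h2 h0 (Real.sqrt_nonneg _)
        _ = _ := Real.mul_self_sqrt h1

theorem sup_apply (F : Set (CStarSeminorm A))
    (hF : ∀ a, BddAbove (Set.range fun p : F => p.1 a)) (a : A) :
    sup F hF a = ⨆ p : F, p.1 a := rfl

/-- The algebra `A`, seen as a seminormed algebra through the C*-seminorm `p`. -/
def Pre (_p : CStarSeminorm A) : Type u := A

section Pre
variable (p : CStarSeminorm A)

instance : SeminormedRing p.Pre where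
  __ := (inferInstance : Ring A)
  __ := p.toSeminorm.toSeminormedAddCommGroup
  norm_mul_le := p.mul_le

instance : StarRing p.Pre := inferInstanceAs (StarRing A)
instance : Algebra ℂ p.Pre := inferInstanceAs (Algebra ℂ A)

instance : NormedAlgebra ℂ p.Pre where
  norm_smul_le c a := (map_smul_eq_mul p.toSeminorm c a).le

instance [StarModule ℂ A] : StarModule ℂ p.Pre := inferInstanceAs (StarModule ℂ A)

/-- The identity map from `A` to its seminormed copy. -/
def toPre : A ≃⋆ₐ[ℂ] p.Pre := StarAlgEquiv.refl ℂ A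

theorem norm_toPre (a : A) : ‖p.toPre a‖ = p a := rfl

theorem norm_star_pre (a : p.Pre) : ‖star a‖ = ‖a‖ := p.star_eq a

instance : NormedStarGroup p.Pre := ⟨fun a => (norm_star_pre p a).le⟩

end Pre

/-- The C*-algebra obtained from `A` by separation and completion with respect to `p`. -/
abbrev Compl (p : CStarSeminorm A) : Type u := UniformSpace.Completion p.Pre

section Compl
variable (p : CStarSeminorm A)

open UniformSpace

instance : NormedAlgebra ℂ p.Compl where
  norm_smul_le := norm_smul_le

/-- The canonical unital ring homomorphism from `A` into its completion. -/
def toComplRingHom : A →+* p.Compl :=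
  (UniformSpace.Completion.coeRingHom : p.Pre →+* Completion p.Pre).comp
    (p.toPre : A →+* p.Pre)

theorem continuous_star_map :
    Continuous (Completion.map (star : p.Pre → p.Pre)) := Completion.continuous_map

theorem map_star_coe (a : p.Pre) :
    Completion.map (star : p.Pre → p.Pre) (a : Completion p.Pre) =
      ((star a : p.Pre) : Completion p.Pre) :=
  Completion.map_coe (starNormedAddGroupHom (E := p.Pre)).uniformContinuous a

instance : StarRing p.Compl where
  star := (Completion.map (star : p.Pre → p.Pre) : Completion p.Pre → Completion p.Pre)
  star_involutive x := by
    change Completion.map star (Completion.map star x) = x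
    induction x using Completion.induction_on with
    | hp => exact isClosed_eq (p.continuous_star_map.comp p.continuous_star_map) continuous_id
    | ih a => rw [map_star_coe, map_star_coe, star_star]
  star_mul x y := by
    change Completion.map star (x * y) =
      (Completion.map star y * Completion.map star x)
    induction x, y using Completion.induction_on₂ with
    | hp =>
      exact isClosed_eq (p.continuous_star_map.comp (by fun_prop))
        ((p.continuous_star_map.comp continuous_snd).mul
          (p.continuous_star_map.comp continuous_fst))
    | ih a b =>
      rw [← Completion.coe_mul, map_star_coe, map_star_coe, map_star_coe, star_mul,
        Completion.coe_mul]
  star_add x y := by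
    change Completion.map star (x + y) =
      (Completion.map star x + Completion.map star y)
    induction x, y using Completion.induction_on₂ with
    | hp =>
      exact isClosed_eq (p.continuous_star_map.comp (by fun_prop))
        ((p.continuous_star_map.comp continuous_fst).add
          (p.continuous_star_map.comp continuous_snd))
    | ih a b =>
      rw [← Completion.coe_add, map_star_coe, map_star_coe, map_star_coe, star_add,
        Completion.coe_add]

instance : CStarRing p.Compl where
  norm_mul_self_le x := by
    change ‖x‖ * ‖x‖ ≤
      ‖(Completion.map star x * x)‖
    induction x using Completion.induction_on with
    | hp =>
      exact isClosed_le (by fun_prop)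
        ((p.continuous_star_map.mul continuous_id).norm)
    | ih a =>
      rw [map_star_coe, ← Completion.coe_mul, Completion.norm_coe, Completion.norm_coe]
      exact (p.star_mul_self a).ge

/-- The canonical *-homomorphism from `A` into its completion. -/
def toCompl : A →⋆ₐ[ℂ] p.Compl where
  __ := p.toComplRingHom
  commutes' _ := rfl
  map_star' a := (p.map_star_coe (p.toPre a)).symm

theorem norm_toCompl (a : A) : ‖p.toCompl a‖ = p a :=
  Completion.norm_coe (E := p.Pre) (p.toPre a)

theorem denseRange_toCompl : DenseRange p.toCompl :=
  Completion.denseRange_coe (α := p.Pre)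

instance [StarModule ℂ A] : StarModule ℂ p.Compl where
  star_smul c x := by
    have h : star (algebraMap ℂ p.Compl c) = algebraMap ℂ p.Compl (star c) := by
      rw [← p.toCompl.commutes', ← p.toCompl.commutes']
      change star (p.toCompl _) = p.toCompl _
      rw [← map_star, algebraMap_star_comm]
    rw [Algebra.smul_def, Algebra.smul_def, star_mul, h, Algebra.commutes]

instance [StarModule ℂ A] : CStarAlgebra p.Compl where

end Compl
end CStarSeminorm

/-! ### The maximal tensor product -/

section MaxTensor

variable (A : Type u) (B : Type v) [CStarAlgebra A] [CStarAlgebra B]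

theorem CStarSeminorm.le_norm {A : Type u} [CStarAlgebra A] (p : CStarSeminorm A) (a : A) :
    p a ≤ ‖a‖ := by
  rw [← p.norm_toCompl]
  exact NonUnitalStarAlgHom.norm_apply_le p.toCompl a

/-- Restriction of a C*-seminorm along a unital *-homomorphism. -/
def CStarSeminorm.comap {A : Type u} {B : Type v} [Ring A] [StarRing A] [Algebra ℂ A]
    [Ring B] [StarRing B] [Algebra ℂ B] (p : CStarSeminorm B) (f : A →⋆ₐ[ℂ] B) :
    CStarSeminorm A where
  toSeminorm := p.toSeminorm.comp (f : A →ₐ[ℂ] B).toLinearMap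
  mul_le' a b := by
    change p (f (a * b)) ≤ p (f a) * p (f b)
    rw [map_mul]; exact p.mul_le _ _
  star_mul_self' a := by
    change p (f (star a * a)) = p (f a) * p (f a)
    rw [map_mul, map_star]; exact p.star_mul_self _

/-- The inclusion `a ↦ a ⊗ 1` into the algebraic tensor product. -/
def algInl : A →⋆ₐ[ℂ] A ⊗[ℂ] B where
  __ := (Algebra.TensorProduct.includeLeft : A →ₐ[ℂ] A ⊗[ℂ] B)
  map_star' a := by simp

/-- The inclusion `b ↦ 1 ⊗ b` into the algebraic tensor product. -/
def algInr : B →⋆ₐ[ℂ] A ⊗[ℂ] B where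
  __ := (Algebra.TensorProduct.includeRight : B →ₐ[ℂ] A ⊗[ℂ] B)
  map_star' a := by simp

theorem tensor_le (p : CStarSeminorm (A ⊗[ℂ] B)) (a : A) (b : B) :
    p (a ⊗ₜ b) ≤ ‖a‖ * ‖b‖ := by
  have h : a ⊗ₜ[ℂ] b = algInl A B a * algInr A B b := by
    change a ⊗ₜ[ℂ] b = (a ⊗ₜ[ℂ] (1 : B)) * ((1 : A) ⊗ₜ[ℂ] b)
    simp
  rw [h]
  exact (p.mul_le _ _).trans (mul_le_mul ((p.comap (algInl A B)).le_norm a)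
    ((p.comap (algInr A B)).le_norm b) (p.nonneg _) (norm_nonneg _))

theorem tensor_bdd (x : A ⊗[ℂ] B) : BddAbove (Set.range
    fun p : (Set.univ : Set (CStarSeminorm (A ⊗[ℂ] B))) => p.1 x) := by
  induction x using TensorProduct.induction_on with
  | zero =>
    refine ⟨0, ?_⟩
    rintro _ ⟨p, rfl⟩
    exact (map_zero p.1.toSeminorm).le
  | tmul a b =>
    refine ⟨‖a‖ * ‖b‖, ?_⟩
    rintro _ ⟨p, rfl⟩
    exact tensor_le A B p.1 a b
  | add x y hx hy =>
    obtain ⟨c, hc⟩ := hx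
    obtain ⟨d, hd⟩ := hy
    refine ⟨c + d, ?_⟩
    rintro _ ⟨p, rfl⟩
    exact (map_add_le_add p.1.toSeminorm x y).trans
      (add_le_add (hc ⟨p, rfl⟩) (hd ⟨p, rfl⟩))

/-- The maximal C*-norm on the algebraic tensor product: the supremum of all C*-seminorms. -/
def maxSeminorm : CStarSeminorm (A ⊗[ℂ] B) := CStarSeminorm.sup Set.univ (tensor_bdd A B)

/-- The maximal tensor product of two unital C*-algebras. -/
abbrev MaxTensor : Type (max u v) := (maxSeminorm A B).Compl

variable {A B}

/-- The elementary tensor `a ⊗ b` in the maximal tensor product. -/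
def maxTmul (a : A) (b : B) : MaxTensor A B := (maxSeminorm A B).toCompl (a ⊗ₜ[ℂ] b)

end MaxTensor

/-! ### C*-algebras given by generators and relations -/

/-- Words in the letters `x_i` (encoded as `(i, false)`) and `x_i^*` (encoded as `(i, true)`). -/
def StarWord (ι : Type u) : Type u := FreeMonoid (ι × Bool)

namespace StarWord

variable {ι : Type u}

instance : Monoid (StarWord ι) := inferInstanceAs (Monoid (FreeMonoid (ι × Bool)))

/-- The adjoint of a word: reverse the word, and exchange `x_i` with `x_i^*`. -/
def adj (w : FreeMonoid (ι × Bool)) : FreeMonoid (ι × Bool) :=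
  FreeMonoid.map (fun l : ι × Bool => (l.1, !l.2)) (star w)

theorem adj_adj (w : FreeMonoid (ι × Bool)) : adj (adj w) = w := by
  have h : ∀ l : List (ι × Bool), List.map (fun l : ι × Bool => (l.1, !l.2))
      (List.reverse (List.map (fun l : ι × Bool => (l.1, !l.2)) (List.reverse l))) = l := by
    intro l
    simp [← List.map_reverse, Function.comp_def]
  exact h (FreeMonoid.toList w)

theorem adj_mul (v w : FreeMonoid (ι × Bool)) : adj (v * w) = adj w * adj v := by
  rw [adj, star_mul, map_mul, adj, adj]

instance : StarMul (StarWord ι) where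
  star := adj
  star_involutive := adj_adj
  star_mul := adj_mul

/-- The one-letter word `x_i`. -/
def letter (i : ι) : StarWord ι := FreeMonoid.of (i, false)

end StarWord

/-- The free unital complex *-algebra `ℂ⟨x_i, x_i^*⟩`. -/
abbrev FreeStarAlgebra (ι : Type u) : Type u := MonoidAlgebra ℂ (StarWord ι)

namespace FreeStarAlgebra

variable {ι : Type u}

/-- The conjugate-linear extension of the adjoint of words. -/
def starHom : FreeStarAlgebra ι →+ FreeStarAlgebra ι :=
  (Finsupp.liftAddHom fun w : StarWord ι =>
    (MonoidAlgebra.singleAddHom (star w)).comp (starRingEnd ℂ : ℂ →+ ℂ)).comp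
      (MonoidAlgebra.coeffAddEquiv : FreeStarAlgebra ι ≃+ _).toAddMonoidHom

theorem starHom_single (w : StarWord ι) (c : ℂ) :
    starHom (MonoidAlgebra.single w c) = MonoidAlgebra.single (star w) (star c) := by
  simp [starHom]

instance : StarRing (FreeStarAlgebra ι) where
  star := starHom
  star_involutive f := by
    induction f using MonoidAlgebra.induction_linear with
    | zero => simp
    | add f g hf hg => rw [map_add, map_add, hf, hg]
    | single w c => rw [starHom_single, starHom_single, star_star, star_star]
  star_mul f g := by
    change starHom (f * g) = starHom g * starHom f
    induction f using MonoidAlgebra.induction_linear with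
    | zero => simp
    | add f f' hf hf' => rw [add_mul, map_add, map_add, mul_add, hf, hf']
    | single w c =>
      induction g using MonoidAlgebra.induction_linear with
      | zero => simp
      | add g g' hg hg' => rw [mul_add, map_add, map_add, add_mul, hg, hg']
      | single v d =>
        rw [MonoidAlgebra.single_mul_single, starHom_single, starHom_single, starHom_single,
          MonoidAlgebra.single_mul_single, star_mul, star_mul]
  star_add f g := map_add starHom f g

theorem star_single (w : StarWord ι) (c : ℂ) :
    star (MonoidAlgebra.single w c : FreeStarAlgebra ι) =
      MonoidAlgebra.single (star w) (star c) := starHom_single w c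

instance : StarModule ℂ (FreeStarAlgebra ι) where
  star_smul c f := by
    induction f using MonoidAlgebra.induction_linear with
    | zero => simp
    | add f g hf hg => rw [smul_add, star_add, hf, hg, star_add, smul_add]
    | single w d =>
      rw [MonoidAlgebra.smul_single, star_single, star_single, MonoidAlgebra.smul_single,
        star_smul]

/-- The generator `x_i`. -/
def X (i : ι) : FreeStarAlgebra ι := MonoidAlgebra.single (StarWord.letter i) 1

theorem star_X (i : ι) :
    star (X i) = (MonoidAlgebra.single (FreeMonoid.of (i, true) : FreeMonoid (ι × Bool)) 1 :
      FreeStarAlgebra ι) := by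
  rw [X, star_single, star_one]
  rfl

/-- A *-subalgebra which contains the generators is everything. -/
theorem mem_of_X_mem (S : StarSubalgebra ℂ (FreeStarAlgebra ι)) (h : ∀ i, X i ∈ S)
    (f : FreeStarAlgebra ι) : f ∈ S := by
  have h1 : ∀ w : FreeMonoid (ι × Bool),
      (MonoidAlgebra.single w 1 : MonoidAlgebra ℂ (StarWord ι)) ∈ S := by
    intro w
    induction w using FreeMonoid.recOn with
    | one => exact one_mem S
    | of_mul l w ih =>
      have h2 : (MonoidAlgebra.single (FreeMonoid.of l * w : FreeMonoid (ι × Bool)) 1 :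
          MonoidAlgebra ℂ (StarWord ι)) =
          (MonoidAlgebra.single (FreeMonoid.of l : FreeMonoid (ι × Bool)) 1 :
            MonoidAlgebra ℂ (StarWord ι)) *
          (MonoidAlgebra.single w 1 : MonoidAlgebra ℂ (StarWord ι)) := by
        have h3 := MonoidAlgebra.single_mul_single (R := ℂ) (FreeMonoid.of l : StarWord ι)
          (w : StarWord ι) 1 1
        rw [one_mul] at h3
        exact h3.symm
      rw [h2]
      refine mul_mem ?_ ih
      obtain ⟨i, b⟩ := l
      cases b with
      | false => exact h i
      | true =>
        rw [← star_X]
        exact star_mem (h i)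
  induction f using MonoidAlgebra.induction_linear with
  | zero => exact zero_mem S
  | add f g hf hg => exact add_mem hf hg
  | single w c =>
    have h3 : (MonoidAlgebra.single w c : MonoidAlgebra ℂ (StarWord ι)) =
        c • (MonoidAlgebra.single w 1 : MonoidAlgebra ℂ (StarWord ι)) := by
      rw [MonoidAlgebra.smul_single, smul_eq_mul, mul_one]
    rw [h3]
    exact S.smul_mem (h1 w) c

end FreeStarAlgebra

/-- The C*-seminorms on `ℂ⟨x_i, x_i^*⟩` which vanish on the relators `R`. -/
def admissible {ι : Type u} (R : Set (FreeStarAlgebra ι)) :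
    Set (CStarSeminorm (FreeStarAlgebra ι)) :=
  {p | ∀ r ∈ R, p r = 0}

/-- The relations `R` bound the norm of each generator. This is the condition under which
the universal C*-algebra `C*(x_i | R)` exists. -/
class BoundedRelations {ι : Type u} (R : Set (FreeStarAlgebra ι)) : Prop where
  bdd : ∀ i, BddAbove (Set.range fun p : admissible R => p.1 (FreeStarAlgebra.X i))

theorem admissible_bdd {ι : Type u} (R : Set (FreeStarAlgebra ι)) [BoundedRelations R]
    (f : FreeStarAlgebra ι) : BddAbove (Set.range fun p : admissible R => p.1 f) := by
  have key : f ∈ ({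
      carrier := {f | BddAbove (Set.range fun p : admissible R => p.1 f)}
      mul_mem' := by
        rintro x y ⟨c, hc⟩ ⟨d, hd⟩
        refine ⟨c * d, ?_⟩
        rintro _ ⟨p, rfl⟩
        exact (p.1.mul_le x y).trans (mul_le_mul (hc ⟨p, rfl⟩) (hd ⟨p, rfl⟩) (p.1.nonneg y)
          ((p.1.nonneg x).trans (hc ⟨p, rfl⟩)))
      add_mem' := by
        rintro x y ⟨c, hc⟩ ⟨d, hd⟩
        refine ⟨c + d, ?_⟩
        rintro _ ⟨p, rfl⟩
        exact (map_add_le_add p.1.toSeminorm x y).trans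
          (add_le_add (hc ⟨p, rfl⟩) (hd ⟨p, rfl⟩))
      algebraMap_mem' := by
        intro c
        refine ⟨‖c‖ * 1, ?_⟩
        rintro _ ⟨p, rfl⟩
        change p.1 (algebraMap ℂ _ c) ≤ _
        rw [Algebra.algebraMap_eq_smul_one, map_smul_eq_mul]
        exact mul_le_mul_of_nonneg_left p.1.one_le (norm_nonneg c)
      star_mem' := by
        rintro x ⟨c, hc⟩
        refine ⟨c, ?_⟩
        rintro _ ⟨p, rfl⟩
        exact (p.1.star_eq x).le.trans (hc ⟨p, rfl⟩) } :
      StarSubalgebra ℂ (FreeStarAlgebra ι)) :=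
    FreeStarAlgebra.mem_of_X_mem _ (fun i => BoundedRelations.bdd i) f
  exact key

section Pres

variable {ι : Type u} (R : Set (FreeStarAlgebra ι)) [BoundedRelations R]

/-- The universal C*-seminorm for the relations `R`. -/
def univSeminorm : CStarSeminorm (FreeStarAlgebra ι) :=
  CStarSeminorm.sup (admissible R) (admissible_bdd R)

/-- The universal C*-algebra `C*(x_i | r = 0, r ∈ R)`. -/
abbrev CStarPres : Type u := (univSeminorm R).Compl

/-- The class in `C*(x_i | R)` of a noncommutative *-polynomial. -/
def CStarPres.mk : FreeStarAlgebra ι →⋆ₐ[ℂ] CStarPres R := (univSeminorm R).toCompl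

/-- The generator `x_i` of `C*(x_i | R)`. -/
def CStarPres.gen (i : ι) : CStarPres R := CStarPres.mk R (FreeStarAlgebra.X i)

theorem CStarPres.mk_eq_zero {r : FreeStarAlgebra ι} (hr : r ∈ R) : CStarPres.mk R r = 0 := by
  rw [← norm_eq_zero]
  refine ((univSeminorm R).norm_toCompl r).trans ?_
  refine le_antisymm (Real.iSup_le (fun p => (p.2 r hr).le) le_rfl) ((univSeminorm R).nonneg r)

theorem CStarPres.closure_eq_top (S : StarSubalgebra ℂ (CStarPres R))
    (h : ∀ i, CStarPres.gen R i ∈ S) : S.topologicalClosure = ⊤ := by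
  have h1 : ∀ f, CStarPres.mk R f ∈ S := fun f =>
    FreeStarAlgebra.mem_of_X_mem (S.comap (CStarPres.mk R)) h f
  rw [eq_top_iff]
  rintro x -
  have h2 : x ∈ closure (Set.range (CStarPres.mk R)) := (univSeminorm R).denseRange_toCompl x
  exact closure_mono (by rintro _ ⟨f, rfl⟩; exact h1 f) h2

end Pres

/-! ### Closed subspaces of the free sphere, and noncommutative cubes -/

/-- A closed subspace `X` of the free real sphere `S^{N-1}_{ℝ,+}`: a unital C*-algebra `C(X)`
generated by self-adjoint coordinates `x_1, …, x_N` with `x_1² + … + x_N² = 1`, that is, a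
quotient of `C(S^{N-1}_{ℝ,+}) = C*(x_1, …, x_N | x_i = x_i^*, x_1² + … + x_N² = 1)`. -/
structure SphereSubspace (N : ℕ) : Type (u + 1) where
  C : Type u
  [cstar : CStarAlgebra C]
  x : Fin N → C
  star_x : ∀ i, star (x i) = x i
  sum_sq : ∑ i, x i * x i = 1
  dense : (StarAlgebra.adjoin ℂ (Set.range x)).topologicalClosure = ⊤

attribute [instance] SphereSubspace.cstar

/-- The inclusion `X ⊂ Y` of closed subspaces of the free sphere: the coordinates of `Y` restrict
to those of `X`. -/
def SphereSubspace.Included {N : ℕ} (X : SphereSubspace.{u} N) (Y : SphereSubspace.{v} N) : Prop :=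
  ∃ f : Y.C →⋆ₐ[ℂ] X.C, ∀ i, f (Y.x i) = X.x i

/-- The relations `u_g u_h = u_{gh}`, `u_1 = 1`, `u_g^* = u_{g⁻¹}` of a unitary representation. -/
def groupRel (Γ : Type u) [Group Γ] : Set (FreeStarAlgebra Γ) :=
  {r | (∃ g h, r = FreeStarAlgebra.X g * FreeStarAlgebra.X h - FreeStarAlgebra.X (g * h)) ∨
    r = FreeStarAlgebra.X 1 - 1 ∨
    ∃ g, r = star (FreeStarAlgebra.X g) - FreeStarAlgebra.X g⁻¹}

theorem CStarSeminorm.eq_of_sub {A : Type u} [Ring A] [StarRing A] [Algebra ℂ A]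
    (p : CStarSeminorm A) {a b : A} (h : p (a - b) = 0) : p a = p b := by
  have h1 := abs_sub_map_le_sub p.toSeminorm a b
  rw [h] at h1
  linarith [abs_nonpos_iff.1 h1]

instance (Γ : Type u) [Group Γ] : BoundedRelations (groupRel Γ) where
  bdd g := by
    refine ⟨1, ?_⟩
    rintro _ ⟨⟨p, hp⟩, rfl⟩
    change p (FreeStarAlgebra.X g) ≤ 1
    have h1 : p.toCompl (FreeStarAlgebra.X g⁻¹ * FreeStarAlgebra.X g) = 1 := by
      have e1 := hp _ (Or.inl ⟨g⁻¹, g, rfl⟩)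
      have e2 := hp _ (Or.inr (Or.inl rfl))
      rw [← p.norm_toCompl, norm_eq_zero, map_sub, sub_eq_zero] at e1 e2
      rw [e1, inv_mul_cancel, e2, map_one]
    have h2 : p.toCompl (star (FreeStarAlgebra.X g)) = p.toCompl (FreeStarAlgebra.X g⁻¹) := by
      have e1 := hp _ (Or.inr (Or.inr ⟨g, rfl⟩))
      rwa [← p.norm_toCompl, norm_eq_zero, map_sub, sub_eq_zero] at e1
    have h3 : p (FreeStarAlgebra.X g) * p (FreeStarAlgebra.X g) ≤ 1 := by
      rw [← p.star_mul_self, ← p.norm_toCompl, map_mul, h2, ← map_mul, h1,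
        ← map_one p.toCompl, p.norm_toCompl]
      exact p.one_le
    nlinarith [p.nonneg (FreeStarAlgebra.X g)]

/-- The full group C*-algebra `C*(Γ)`. -/
abbrev GroupCStar (Γ : Type u) [Group Γ] : Type u := CStarPres (groupRel Γ)

/-- The canonical unitary representation `Γ → C*(Γ)`. -/
def GroupCStar.of {Γ : Type u} [Group Γ] : Γ →* GroupCStar Γ where
  toFun g := CStarPres.gen (groupRel Γ) g
  map_one' := by
    have h := CStarPres.mk_eq_zero (groupRel Γ) (Or.inr (Or.inl rfl))
    rw [map_sub, sub_eq_zero, map_one] at h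
    exact h
  map_mul' g h := by
    have h := CStarPres.mk_eq_zero (groupRel Γ) (Or.inl ⟨g, h, rfl⟩)
    rw [map_sub, sub_eq_zero, map_mul] at h
    exact h.symm

theorem GroupCStar.star_of {Γ : Type u} [Group Γ] (g : Γ) :
    star (GroupCStar.of g) = GroupCStar.of g⁻¹ := by
  have h := CStarPres.mk_eq_zero (groupRel Γ) (Or.inr (Or.inr ⟨g, rfl⟩))
  rw [map_sub, sub_eq_zero, map_star] at h
  exact h

/-- A reflection group `Γ = ⟨g_1, …, g_N⟩`, with `g_i² = 1`. -/
structure ReflectionGroup (N : ℕ) : Type (u + 1) where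
  Γ : Type u
  [group : Group Γ]
  g : Fin N → Γ
  sq : ∀ i, g i * g i = 1
  gen : Subgroup.closure (Set.range g) = ⊤

attribute [instance] ReflectionGroup.group

/-- The noncommutative cube: the dual of a reflection group `Γ`, with `C(X) = C*(Γ)` and with
coordinates `x_i = g_i / √N`. -/
def ReflectionGroup.cube {N : ℕ} [NeZero N] (G : ReflectionGroup.{u} N) : SphereSubspace.{u} N where
  C := GroupCStar G.Γ
  x i := ((√(N : ℝ) : ℝ) : ℂ)⁻¹ • GroupCStar.of (G.g i)
  star_x i := by
    rw [star_smul, GroupCStar.star_of, inv_eq_of_mul_eq_one_left (G.sq i), star_inv₀]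
    simp
  sum_sq := by
    have hN : (N : ℂ) ≠ 0 := Nat.cast_ne_zero.2 (NeZero.ne N)
    have h : ((√(N : ℝ) : ℝ) : ℂ)⁻¹ * ((√(N : ℝ) : ℝ) : ℂ)⁻¹ = (N : ℂ)⁻¹ := by
      rw [← mul_inv, ← Complex.ofReal_mul, Real.mul_self_sqrt (Nat.cast_nonneg N)]
      simp
    simp_rw [smul_mul_smul_comm, h, ← map_mul, G.sq, map_one]
    rw [Finset.sum_const, Finset.card_univ, Fintype.card_fin, ← Nat.cast_smul_eq_nsmul ℂ,
      smul_smul, mul_inv_cancel₀ hN, one_smul]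
  dense := by
    apply CStarPres.closure_eq_top
    intro γ
    have hN : ((√(N : ℝ) : ℝ) : ℂ) ≠ 0 := by
      rw [Ne, Complex.ofReal_eq_zero, Real.sqrt_eq_zero (Nat.cast_nonneg N)]
      exact Nat.cast_ne_zero.2 (NeZero.ne N)
    have hγ : γ ∈ Subgroup.closure (Set.range G.g) := by rw [G.gen]; trivial
    change GroupCStar.of γ ∈ _
    induction hγ using Subgroup.closure_induction with
    | mem y hy =>
      obtain ⟨i, rfl⟩ := hy
      have h := StarSubalgebra.smul_mem _ (StarAlgebra.subset_adjoin ℂ _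
        (Set.mem_range_self (f := fun i => ((√(N : ℝ) : ℝ) : ℂ)⁻¹ •
          (GroupCStar.of (G.g i) : GroupCStar G.Γ)) i)) ((√(N : ℝ) : ℝ) : ℂ)
      simpa only [smul_smul, mul_inv_cancel₀ hN, one_smul] using h
    | one => rw [map_one]; exact one_mem _
    | mul y z _ _ hy hz => rw [map_mul]; exact mul_mem hy hz
    | inv y _ hy => rw [← GroupCStar.star_of]; exact star_mem hy

/-- The group `ℤ₂^N`, with its standard generators. -/
def cubeGroup (N : ℕ) : ReflectionGroup.{0} N where
  Γ := Fin N → Multiplicative (ZMod 2)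
  g i := Pi.mulSingle i (Multiplicative.ofAdd 1)
  sq i := by
    rw [← Pi.mulSingle_mul]
    have : (Multiplicative.ofAdd (1 : ZMod 2)) * Multiplicative.ofAdd 1 = 1 := by decide
    rw [this, Pi.mulSingle_one]
  gen := by
    rw [eq_top_iff]
    rintro f -
    rw [← Finset.univ_prod_mulSingle f]
    refine Subgroup.prod_mem _ fun i _ => ?_
    have h : ∀ z : Multiplicative (ZMod 2), z = 1 ∨ z = Multiplicative.ofAdd 1 := by decide
    rcases h (f i) with h | h
    · rw [h, Pi.mulSingle_one]
      exact one_mem _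
    · rw [h]
      exact Subgroup.subset_closure ⟨i, rfl⟩

/-- The free product `ℤ₂^{*N}`, with its standard generators. -/
def freeCubeGroup (N : ℕ) : ReflectionGroup.{0} N where
  Γ := Monoid.CoprodI fun _ : Fin N => Multiplicative (ZMod 2)
  g i := Monoid.CoprodI.of (i := i) (Multiplicative.ofAdd 1)
  sq i := by
    rw [← map_mul]
    have : (Multiplicative.ofAdd (1 : ZMod 2)) * Multiplicative.ofAdd 1 = 1 := by decide
    rw [this, map_one]
  gen := by
    rw [eq_top_iff]
    rintro f -
    induction f using Monoid.CoprodI.induction_on with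
    | one => exact one_mem _
    | of i z =>
      have h : ∀ z : Multiplicative (ZMod 2), z = 1 ∨ z = Multiplicative.ofAdd 1 := by decide
      rcases h z with h | h
      · subst h
        rw [map_one (Monoid.CoprodI.of (M := fun _ : Fin N => Multiplicative (ZMod 2)) (i := i))]
        exact one_mem _
      · rw [h]
        exact Subgroup.subset_closure ⟨i, rfl⟩
    | mul x y hx hy => exact mul_mem hx hy

/-- The half-liberated group `ℤ₂^{∘N}`: the quotient of `ℤ₂^{*N}` by the relations `abc = cba`
between the standard generators. -/
def halfCubeGroup (N : ℕ) : ReflectionGroup.{0} N where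
  Γ := (freeCubeGroup N).Γ ⧸ Subgroup.normalClosure
    {r | ∃ i j k, r = (freeCubeGroup N).g i * (freeCubeGroup N).g j * (freeCubeGroup N).g k *
      ((freeCubeGroup N).g k * (freeCubeGroup N).g j * (freeCubeGroup N).g i)⁻¹}
  g i := QuotientGroup.mk ((freeCubeGroup N).g i)
  sq i := by
    rw [← QuotientGroup.mk_mul, (freeCubeGroup N).sq, QuotientGroup.mk_one]
  gen := by
    have h := congrArg (Subgroup.map (QuotientGroup.mk' (Subgroup.normalClosure
      {r | ∃ i j k, r = (freeCubeGroup N).g i * (freeCubeGroup N).g j * (freeCubeGroup N).g k *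
      ((freeCubeGroup N).g k * (freeCubeGroup N).g j * (freeCubeGroup N).g i)⁻¹})))
      (freeCubeGroup N).gen
    rw [MonoidHom.map_closure, ← Set.range_comp, ← MonoidHom.range_eq_map,
      MonoidHom.range_eq_top.2 (QuotientGroup.mk'_surjective _)] at h
    exact h

/-! ### Orthogonal quantum groups -/

/-- A closed subspace `G` of Wang's free orthogonal quantum group `O_N^+`: a unital C*-algebra
`C(G)` generated by the entries of a matrix `u = (u_ij)` with `u = ū`, `u^t = u⁻¹`, that is, a
quotient of the universal such C*-algebra `C(O_N^+)`. -/
structure OrthogonalSubspace (N : ℕ) : Type (u + 1) where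
  C : Type u
  [cstar : CStarAlgebra C]
  u : Fin N → Fin N → C
  star_u : ∀ i j, star (u i j) = u i j
  row : ∀ i j, ∑ k, u i k * u j k = if i = j then 1 else 0
  col : ∀ i j, ∑ k, u k i * u k j = if i = j then 1 else 0
  dense : (StarAlgebra.adjoin ℂ (Set.range fun a : Fin N × Fin N => u a.1 a.2)).topologicalClosure
    = ⊤

attribute [instance] OrthogonalSubspace.cstar

namespace OrthogonalSubspace

variable {N : ℕ}

/-- The inclusion `G ⊂ H` inside `O_N^+`: the coordinates of `H` restrict to those of `G`. -/
def Included (G : OrthogonalSubspace.{u} N) (H : OrthogonalSubspace.{v} N) : Prop :=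
  ∃ f : H.C →⋆ₐ[ℂ] G.C, ∀ i j, f (H.u i j) = G.u i j

/-- The closed subspace `G ⊂ O_N^+` is a compact quantum group: there are unital
*-homomorphisms `Δ : C(G) → C(G) ⊗ C(G)`, `ε : C(G) → ℂ`, `S : C(G) → C(G)^opp` with
`Δ(u_ij) = ∑_k u_ik ⊗ u_kj`, `ε(u_ij) = δ_ij`, `S(u_ij) = u_ji`. Since the `u_ij` generate `C(G)`,
these maps are unique, and the axioms of Hopf algebras hold for them. Here `C(G)` is the full
(universal) algebra of functions, so that the tensor products are the maximal ones. -/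
def IsQuantumGroup (G : OrthogonalSubspace.{u} N) : Prop :=
  (∃ Δ : G.C →⋆ₐ[ℂ] MaxTensor G.C G.C,
    ∀ i j, Δ (G.u i j) = ∑ k, maxTmul (G.u i k) (G.u k j)) ∧
  (∃ ε : G.C →⋆ₐ[ℂ] ℂ, ∀ i j, ε (G.u i j) = if i = j then 1 else 0) ∧
  (∃ S : G.C →⋆ₐ[ℂ] (G.C)ᵐᵒᵖ, ∀ i j, S (G.u i j) = MulOpposite.op (G.u j i))

/-- The affine action of `G ⊂ O_N^+` on `X ⊂ S^{N-1}_{ℝ,+}`: there is a unital *-homomorphism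
`Φ : C(X) → C(G) ⊗ C(X)` with `Φ(x_i) = ∑_j u_ij ⊗ x_j`. Since the `x_i` generate `C(X)`, this
map is unique, and it is automatically coassociative and counital. -/
def ActsAffinely (G : OrthogonalSubspace.{u} N) (X : SphereSubspace.{v} N) : Prop :=
  ∃ Φ : X.C →⋆ₐ[ℂ] MaxTensor G.C X.C, ∀ i, Φ (X.x i) = ∑ j, maxTmul (G.u i j) (X.x j)

/-- The relations `u_ij = u_ij^*`, `∑_k u_ik u_jk = δ_ij`, `∑_k u_ki u_kj = δ_ij` of an
orthogonal matrix. -/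
def orthRel (N : ℕ) : Set (FreeStarAlgebra (Fin N × Fin N)) :=
  {r | (∃ a, r = star (FreeStarAlgebra.X a) - FreeStarAlgebra.X a) ∨
    (∃ i j, r = (∑ k, FreeStarAlgebra.X (i, k) * FreeStarAlgebra.X (j, k)) -
      if i = j then 1 else 0) ∨
    (∃ i j, r = (∑ k, FreeStarAlgebra.X (k, i) * FreeStarAlgebra.X (k, j)) -
      if i = j then 1 else 0)}

instance (R : Set (FreeStarAlgebra (Fin N × Fin N))) : BoundedRelations (orthRel N ∪ R) where
  bdd a := by
    refine ⟨1, ?_⟩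
    rintro _ ⟨⟨p, hp⟩, rfl⟩
    change p (FreeStarAlgebra.X a) ≤ 1
    obtain ⟨i, j⟩ := a
    let _ : PartialOrder p.Compl := CStarAlgebra.spectralOrder _
    have _ : StarOrderedRing p.Compl := CStarAlgebra.spectralOrderedRing _
    have hs : ∀ a, star (p.toCompl (FreeStarAlgebra.X a)) = p.toCompl (FreeStarAlgebra.X a) := by
      intro a
      have e := hp _ (Or.inl (Or.inl ⟨a, rfl⟩))
      rwa [← p.norm_toCompl, norm_eq_zero, map_sub, sub_eq_zero, map_star] at e
    have h1 : ∑ k, star (p.toCompl (FreeStarAlgebra.X (i, k))) *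
        p.toCompl (FreeStarAlgebra.X (i, k)) = 1 := by
      have e := hp _ (Or.inl (Or.inr (Or.inl ⟨i, i, rfl⟩)))
      rw [← p.norm_toCompl, norm_eq_zero, map_sub, sub_eq_zero, if_pos rfl, map_one, map_sum] at e
      rw [← e]
      exact Finset.sum_congr rfl fun k _ => by rw [hs, map_mul]
    have h2 : star (p.toCompl (FreeStarAlgebra.X (i, j))) * p.toCompl (FreeStarAlgebra.X (i, j))
        ≤ 1 := by
      rw [← h1]
      exact Finset.single_le_sum (f := fun k => star (p.toCompl (FreeStarAlgebra.X (i, k))) *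
        p.toCompl (FreeStarAlgebra.X (i, k))) (fun k _ => star_mul_self_nonneg _)
        (Finset.mem_univ j)
    have h3 := CStarAlgebra.norm_le_norm_of_nonneg_of_le (star_mul_self_nonneg _) h2
    have h4 : ‖(1 : p.Compl)‖ ≤ 1 := by
      rw [← map_one p.toCompl, p.norm_toCompl]
      exact p.one_le
    rw [CStarRing.norm_star_mul_self, p.norm_toCompl] at h3
    nlinarith [p.nonneg (FreeStarAlgebra.X (i, j))]

/-- The closed subspace of `O_N^+` obtained by imposing the relations `R` on the coordinates. -/
def ofRelations (R : Set (FreeStarAlgebra (Fin N × Fin N))) : OrthogonalSubspace.{0} N where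
  C := CStarPres (orthRel N ∪ R)
  u i j := CStarPres.gen (orthRel N ∪ R) (i, j)
  star_u i j := by
    have e := CStarPres.mk_eq_zero (orthRel N ∪ R) (Or.inl (Or.inl ⟨(i, j), rfl⟩))
    rwa [map_sub, sub_eq_zero, map_star] at e
  row i j := by
    have e := CStarPres.mk_eq_zero (orthRel N ∪ R) (Or.inl (Or.inr (Or.inl ⟨i, j, rfl⟩)))
    rw [map_sub, sub_eq_zero, map_sum] at e
    simp only [map_mul, apply_ite (CStarPres.mk (orthRel N ∪ R)), map_one, map_zero] at e
    exact e
  col i j := by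
    have e := CStarPres.mk_eq_zero (orthRel N ∪ R) (Or.inl (Or.inr (Or.inr ⟨i, j, rfl⟩)))
    rw [map_sub, sub_eq_zero, map_sum] at e
    simp only [map_mul, apply_ite (CStarPres.mk (orthRel N ∪ R)), map_one, map_zero] at e
    exact e
  dense := CStarPres.closure_eq_top _ _ fun a =>
    StarAlgebra.subset_adjoin ℂ _ (Set.mem_range_self a)

open FreeStarAlgebra (X)

/-- The twisted orthogonal quantum group `Ō_N` (the twist of `O_N` at `q = -1`): the entries
`a ≠ b` on the same row or column of `u` anticommute, and all the other pairs commute. -/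
def twistedO (N : ℕ) : OrthogonalSubspace.{0} N := ofRelations
  {r | ∃ a b : Fin N × Fin N,
    (a ≠ b ∧ (a.1 = b.1 ∨ a.2 = b.2) ∧ r = X a * X b - -(X b * X a)) ∨
    (¬ (a ≠ b ∧ (a.1 = b.1 ∨ a.2 = b.2)) ∧ r = X a * X b - X b * X a)}

/-- The relations `ab = 0`, for entries `a ≠ b` on the same row or column of `u`. -/
def cubicRel (N : ℕ) : Set (FreeStarAlgebra (Fin N × Fin N)) :=
  {r | ∃ a b : Fin N × Fin N, a ≠ b ∧ (a.1 = b.1 ∨ a.2 = b.2) ∧ r = X a * X b}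

/-- The free hyperoctahedral quantum group `H_N^+`. -/
def freeH (N : ℕ) : OrthogonalSubspace.{0} N := ofRelations (cubicRel N)

/-- The half-liberated hyperoctahedral quantum group `H_N^* ⊂ H_N^+`, obtained by imposing the
half-commutation relations `abc = cba` on the entries of `u`. -/
def halfH (N : ℕ) : OrthogonalSubspace.{0} N := ofRelations
  (cubicRel N ∪ {r | ∃ a b c : Fin N × Fin N, r = X a * X b * X c - X c * X b * X a})

end OrthogonalSubspace

/-- `Q` is the quantum affine isometry group `G^+(X)`: the largest compact quantum group
`G ⊂ O_N^+` which acts affinely on `X`. -/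
def IsQuantumIsometryGroup {N : ℕ} (X : SphereSubspace.{0} N) (Q : OrthogonalSubspace.{0} N) :
    Prop :=
  Q.IsQuantumGroup ∧ Q.ActsAffinely X ∧
    ∀ G : OrthogonalSubspace.{u} N, G.IsQuantumGroup → G.ActsAffinely X → G.Included Q

end NCCube

end

-- Put `y i = ∑ j, u i j ⊗ g j`. After removing the factor `1/√N`, an affine action on the cube of
-- `Γ` is a *-homomorphism sending `g i` to `y i`. For the three groups at hand it exists as soon as
-- the `y i` satisfy the defining relations of the generators. The theorem translates these
-- relations into relations between the `u i j`.
--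
-- Existence: cubic entries give `y i ^ 2 = ∑ j, u i j ^ 2 ⊗ 1 = 1`; half-commutation passes to the
-- `y i` because both tensor factors half-commute; twisted entries make the mixed terms of `y i ^ 2`
-- cancel in pairs and those of `y i * y j - y j * y i` cancel one by one. The relations are stable
-- under matrix product in the tensor product, hold for the identity matrix, and survive
-- transposition in the opposite algebra, so the three universal objects are quantum groups.
--
-- Maximality: the relations of the `y i` are expanded and coefficients in the group variable are
-- compared. `exists_coefficient` extracts them through a finite quotient of `Γ`, by a matrix entry
-- of the regular representation, so no faithfulness of an infinite regular representation is
-- needed. Dihedral quotients of order 14 suffice for the free and half-liberated groups, and `ℤ₂ ×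
-- ℤ₂` for `ℤ₂^N`. In the free case this gives the row relations, and the antipode gives the column
-- ones (`isCubic_of_actsAffinely`). In the other two cases a coefficient sees only a sum of
-- monomials that coincide in `Γ`; adding its transpose under the antipode isolates twice the wanted
-- identity (`isTwisted_of_actsAffinely`, `isHalfCommuting_of_actsAffinely`). The half-commutations
-- missed in this way need squares of entries to be central, which is `commute_sq_of_isCubic`.
--
-- The non-inclusions come from explicit matrices over the algebra generated by two anticommuting
-- symmetries.

universe w

namespace NCCube

/-! ### Universal properties -/

namespace CStarSeminorm

/-- The C*-seminorm induced by a unital *-homomorphism into a C*-algebra. -/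
noncomputable def ofHom {A : Type u} {D : Type v} [Ring A] [StarRing A] [Algebra ℂ A]
    [CStarAlgebra D] (φ : A →⋆ₐ[ℂ] D) : CStarSeminorm A where
  toSeminorm := (normSeminorm ℂ D).comp (φ : A →ₐ[ℂ] D).toLinearMap
  mul_le' a b := by
    change ‖φ (a * b)‖ ≤ ‖φ a‖ * ‖φ b‖
    rw [map_mul]
    exact norm_mul_le _ _
  star_mul_self' a := by
    change ‖φ (star a * a)‖ = ‖φ a‖ * ‖φ a‖
    rw [map_mul, map_star]
    exact CStarRing.norm_star_mul_self

theorem ofHom_apply {A : Type u} {D : Type v} [Ring A] [StarRing A] [Algebra ℂ A]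
    [CStarAlgebra D] (φ : A →⋆ₐ[ℂ] D) (a : A) : ofHom φ a = ‖φ a‖ := rfl

/-- A *-homomorphism which is bounded by `p` extends to the completion with respect to `p`. -/
theorem exists_extension {A : Type u} {D : Type v} [Ring A] [StarRing A] [Algebra ℂ A]
    [CStarAlgebra D] (p : CStarSeminorm A) (φ : A →⋆ₐ[ℂ] D) (h : ∀ a, ‖φ a‖ ≤ p a) :
    ∃ ψ : p.Compl →⋆ₐ[ℂ] D, ∀ a, ψ (p.toCompl a) = φ a := by
  let f : p.Pre →+* D := (φ : A →+* D)
  have hf : Continuous f :=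
    AddMonoidHomClass.continuous_of_bound f 1 fun a => (h a).trans (one_mul (p a)).ge
  have hc : Continuous (UniformSpace.Completion.extensionHom f hf) :=
    UniformSpace.Completion.continuous_extension
  have hcoe : ∀ a : A, UniformSpace.Completion.extensionHom f hf (p.toCompl a) = φ a :=
    fun a => UniformSpace.Completion.extensionHom_coe f hf a
  refine ⟨{ toRingHom := UniformSpace.Completion.extensionHom f hf
            commutes' := fun c => ?_
            map_star' := fun x => ?_ }, hcoe⟩
  · change UniformSpace.Completion.extensionHom f hf (algebraMap ℂ p.Compl c) = _
    rw [← p.toCompl.commutes', ← φ.commutes']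
    exact hcoe _
  · change UniformSpace.Completion.extensionHom f hf (star x) =
      star (UniformSpace.Completion.extensionHom f hf x)
    refine p.denseRange_toCompl.induction_on (p := fun x =>
      UniformSpace.Completion.extensionHom f hf (star x) =
        star (UniformSpace.Completion.extensionHom f hf x)) x ?_ fun a => ?_
    · exact isClosed_eq (hc.comp p.continuous_star_map) (continuous_star.comp hc)
    · rw [← map_star, hcoe, hcoe, map_star]

end CStarSeminorm

namespace FreeStarAlgebra

variable {ι : Type u} {D : Type v} [Ring D] [StarRing D]

/-- Evaluation of words. -/
def wordEval (x : ι → D) : StarWord ι →* D :=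
  (FreeMonoid.lift fun l : ι × Bool => if l.2 then star (x l.1) else x l.1 :
    FreeMonoid (ι × Bool) →* D)

theorem wordEval_letter (x : ι → D) (i : ι) : wordEval x (StarWord.letter i) = x i := by
  change (FreeMonoid.lift _) (FreeMonoid.of (i, false)) = _
  rw [FreeMonoid.lift_eval_of]
  simp

theorem wordEval_star (x : ι → D) (w : StarWord ι) :
    wordEval x (star w) = star (wordEval x w) := by
  change FreeMonoid (ι × Bool) at w
  induction w using FreeMonoid.recOn with
  | one =>
    change wordEval x (star (1 : StarWord ι)) = star (wordEval x (1 : StarWord ι))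
    rw [star_one, map_one, star_one]
  | of_mul l w ih =>
    have h1 : wordEval x (star (FreeMonoid.of l : StarWord ι)) =
        star (wordEval x (FreeMonoid.of l : StarWord ι)) := by
      change (FreeMonoid.lift _) (FreeMonoid.of (l.1, !l.2)) =
        star ((FreeMonoid.lift _) (FreeMonoid.of l))
      rw [FreeMonoid.lift_eval_of, FreeMonoid.lift_eval_of]
      rcases l with ⟨i, b⟩
      cases b <;> simp
    have h2 : ∀ a b : StarWord ι, wordEval x (star a) = star (wordEval x a) →
        wordEval x (star b) = star (wordEval x b) →
        wordEval x (star (a * b)) = star (wordEval x (a * b)) := fun a b ha hb => by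
      rw [star_mul, map_mul, map_mul, star_mul, ha, hb]
    exact h2 _ _ h1 ih

/-- The universal property of the free *-algebra. -/
noncomputable def lift [Algebra ℂ D] [StarModule ℂ D] (x : ι → D) : FreeStarAlgebra ι →⋆ₐ[ℂ] D where
  __ := MonoidAlgebra.lift ℂ D (StarWord ι) (wordEval x)
  map_star' f := by
    change MonoidAlgebra.lift ℂ D (StarWord ι) (wordEval x) (star f) =
      star (MonoidAlgebra.lift ℂ D (StarWord ι) (wordEval x) f)
    induction f using MonoidAlgebra.induction_linear with
    | zero => simp
    | add f g hf hg => rw [star_add, map_add, map_add, hf, hg, star_add]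
    | single w c =>
      rw [star_single, MonoidAlgebra.lift_single, MonoidAlgebra.lift_single, wordEval_star,
        star_smul]

theorem lift_X [Algebra ℂ D] [StarModule ℂ D] (x : ι → D) (i : ι) : lift x (X i) = x i := by
  change MonoidAlgebra.lift ℂ D (StarWord ι) (wordEval x) (MonoidAlgebra.single _ 1) = _
  rw [MonoidAlgebra.lift_single, one_smul, wordEval_letter]

end FreeStarAlgebra

/-- The universal property of a C*-algebra given by generators and relations. -/
theorem CStarPres.exists_hom {ι : Type u} {D : Type v} [CStarAlgebra D]
    (R : Set (FreeStarAlgebra ι)) [BoundedRelations R] (x : ι → D)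
    (h : ∀ r ∈ R, FreeStarAlgebra.lift x r = 0) :
    ∃ ψ : CStarPres R →⋆ₐ[ℂ] D, ∀ i, ψ (CStarPres.gen R i) = x i := by
  -- The seminorm `‖lift x ·‖` kills the relators, so it is one of the seminorms whose supremum is
  -- the universal one.
  obtain ⟨ψ, hψ⟩ := (univSeminorm R).exists_extension (FreeStarAlgebra.lift x) fun a =>
    le_ciSup (admissible_bdd R a) ⟨CStarSeminorm.ofHom (FreeStarAlgebra.lift x), fun r hr => by
      rw [CStarSeminorm.ofHom_apply, h r hr, norm_zero]⟩
  exact ⟨ψ, fun i => (hψ _).trans (FreeStarAlgebra.lift_X x i)⟩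

/-- The universal property of the full group C*-algebra. -/
theorem GroupCStar.exists_hom {Γ : Type u} [Group Γ] {D : Type v} [CStarAlgebra D] (ρ : Γ →* D)
    (h : ∀ γ, star (ρ γ) = ρ γ⁻¹) :
    ∃ ψ : GroupCStar Γ →⋆ₐ[ℂ] D, ∀ γ, ψ (GroupCStar.of γ) = ρ γ := by
  refine CStarPres.exists_hom (groupRel Γ) ρ ?_
  rintro r (⟨g, h, rfl⟩ | rfl | ⟨g, rfl⟩)
  · simp [FreeStarAlgebra.lift_X]
  · simp [FreeStarAlgebra.lift_X]
  · rw [map_sub, map_star, FreeStarAlgebra.lift_X, FreeStarAlgebra.lift_X, h, sub_self]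

/-! ### The maximal tensor product -/

section MaxTensor

variable {A : Type u} {B : Type v} [CStarAlgebra A] [CStarAlgebra B]

theorem maxTmul_mul (a a' : A) (b b' : B) :
    maxTmul a b * maxTmul a' b' = maxTmul (a * a') (b * b') := by
  rw [maxTmul, maxTmul, ← map_mul, Algebra.TensorProduct.tmul_mul_tmul]
  rfl

theorem star_maxTmul (a : A) (b : B) : star (maxTmul a b) = maxTmul (star a) (star b) := by
  rw [maxTmul, ← map_star, TensorProduct.star_tmul]
  rfl

theorem maxTmul_one_one : maxTmul (1 : A) (1 : B) = 1 :=
  map_one (maxSeminorm A B).toCompl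

theorem sub_maxTmul (a a' : A) (b : B) : maxTmul (a - a') b = maxTmul a b - maxTmul a' b := by
  rw [maxTmul, TensorProduct.sub_tmul, map_sub]
  rfl

theorem neg_maxTmul (a : A) (b : B) : maxTmul (-a) b = -maxTmul a b := by
  rw [maxTmul, TensorProduct.neg_tmul, map_neg]
  rfl

theorem maxTmul_neg (a : A) (b : B) : maxTmul a (-b) = -maxTmul a b := by
  rw [maxTmul, TensorProduct.tmul_neg, map_neg]
  rfl

theorem zero_maxTmul (b : B) : maxTmul (0 : A) b = 0 := by
  rw [maxTmul, TensorProduct.zero_tmul, map_zero]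

theorem maxTmul_zero (a : A) : maxTmul a (0 : B) = 0 := by
  rw [maxTmul, TensorProduct.tmul_zero, map_zero]

theorem maxTmul_smul (c : ℂ) (a : A) (b : B) : maxTmul a (c • b) = c • maxTmul a b := by
  rw [maxTmul, TensorProduct.tmul_smul, map_smul]
  rfl

theorem sum_maxTmul {κ : Type*} (s : Finset κ) (a : κ → A) (b : B) :
    maxTmul (∑ k ∈ s, a k) b = ∑ k ∈ s, maxTmul (a k) b := by
  rw [maxTmul, TensorProduct.sum_tmul, map_sum]
  rfl

theorem maxTmul_sum {κ : Type*} (s : Finset κ) (a : A) (b : κ → B) :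
    maxTmul a (∑ k ∈ s, b k) = ∑ k ∈ s, maxTmul a (b k) := by
  rw [maxTmul, TensorProduct.tmul_sum, map_sum]
  rfl

/-- The universal property of the maximal tensor product. -/
theorem MaxTensor.exists_hom {D : Type w} [CStarAlgebra D] (f : A →⋆ₐ[ℂ] D) (g : B →⋆ₐ[ℂ] D)
    (h : ∀ a b, Commute (f a) (g b)) :
    ∃ ψ : MaxTensor A B →⋆ₐ[ℂ] D, ∀ a b, ψ (maxTmul a b) = f a * g b := by
  let φ : A ⊗[ℂ] B →ₐ[ℂ] D := Algebra.TensorProduct.lift (f : A →ₐ[ℂ] D) (g : B →ₐ[ℂ] D) h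
  have hφ : ∀ a b, φ (a ⊗ₜ b) = f a * g b := fun a b => by
    simp [φ]
  let φ' : A ⊗[ℂ] B →⋆ₐ[ℂ] D :=
    { φ with
      map_star' := fun x => by
        change φ (star x) = star (φ x)
        induction x using TensorProduct.induction_on with
        | zero => simp
        | tmul a b =>
          rw [TensorProduct.star_tmul, hφ, hφ, star_mul, map_star, map_star]
          simpa only [map_star] using (h (star a) (star b)).eq
        | add x y hx hy => rw [star_add, map_add, map_add, hx, hy, star_add] }
  obtain ⟨ψ, hψ⟩ := (maxSeminorm A B).exists_extension φ' fun x =>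
    le_ciSup (tensor_bdd A B x) ⟨CStarSeminorm.ofHom φ', trivial⟩
  exact ⟨ψ, fun a b => (hψ _).trans (hφ a b)⟩

end MaxTensor

/-! ### Homomorphisms out of reflection groups -/

namespace ReflectionGroup

variable {N : ℕ}

/-- A representation of a reflection group by self-adjoint involutions extends to the full group
C*-algebra. -/
theorem exists_hom (S : ReflectionGroup.{u} N) {D : Type v} [CStarAlgebra D] (ρ : S.Γ →* Dˣ)
    (hs : ∀ i, star (ρ (S.g i) : D) = ρ (S.g i)) :
    ∃ ψ : GroupCStar S.Γ →⋆ₐ[ℂ] D, ∀ γ, ψ (GroupCStar.of γ) = ρ γ := by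
  refine GroupCStar.exists_hom ((Units.coeHom D).comp ρ) fun γ => ?_
  have hγ : γ ∈ Subgroup.closure (Set.range S.g) := by rw [S.gen]; trivial
  change star (ρ γ : D) = (ρ γ⁻¹ : Dˣ)
  -- The identity is moved to the unit group, where induction over the subgroup generated by the
  -- reflections can handle inverses.
  suffices h : star (ρ γ) = ρ γ⁻¹ by rw [← h, Units.coe_star]
  induction hγ using Subgroup.closure_induction with
  | mem y hy =>
    obtain ⟨i, rfl⟩ := hy
    rw [inv_eq_of_mul_eq_one_left (S.sq i)]
    exact Units.ext (hs i)
  | one => simp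
  | mul y z _ _ hy hz => rw [map_mul, star_mul, hy, hz, mul_inv_rev, map_mul]
  | inv y _ hy => rw [← star_star (ρ y⁻¹⁻¹), inv_inv, hy]

/-- A homomorphism of reflection groups mapping generators to generators gives an inclusion of
cubes. -/
theorem cube_included_of_hom [NeZero N] (S : ReflectionGroup.{u} N) (T : ReflectionGroup.{v} N)
    (ρ : S.Γ →* T.Γ) (h : ∀ i, ρ (S.g i) = T.g i) : T.cube.Included S.cube := by
  obtain ⟨ψ, hψ⟩ := GroupCStar.exists_hom (GroupCStar.of.comp ρ) fun γ => by
    simp [GroupCStar.star_of]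
  refine ⟨ψ, fun i => ?_⟩
  change ψ (_ • GroupCStar.of (S.g i)) = _ • GroupCStar.of (T.g i)
  rw [map_smul, hψ, MonoidHom.comp_apply, h]

end ReflectionGroup

/-- The homomorphism from `ℤ₂` determined by an involution. -/
def involutionHom {M : Type*} [Monoid M] (x : M) (hx : x * x = 1) :
    Multiplicative (ZMod 2) →* M where
  toFun z := if z = 1 then 1 else x
  map_one' := if_pos rfl
  map_mul' a b := by
    have h : ∀ z : Multiplicative (ZMod 2), z = 1 ∨ z = Multiplicative.ofAdd 1 := by decide
    have h1 : Multiplicative.ofAdd (1 : ZMod 2) ≠ 1 := by decide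
    have h2 : Multiplicative.ofAdd (1 : ZMod 2) * Multiplicative.ofAdd 1 = 1 := by decide
    rcases h a with rfl | rfl <;> rcases h b with rfl | rfl <;> simp [h1, h2, hx]

theorem involutionHom_apply {M : Type*} [Monoid M] (x : M) (hx : x * x = 1) :
    involutionHom x hx (Multiplicative.ofAdd 1) = x := by
  change (if Multiplicative.ofAdd (1 : ZMod 2) = 1 then 1 else x) = x
  exact if_neg (by decide)

theorem exists_freeCubeGroup_hom {N : ℕ} {H : Type*} [Group H] (x : Fin N → H)
    (hx : ∀ i, x i * x i = 1) :
    ∃ ρ : (freeCubeGroup N).Γ →* H, ∀ i, ρ ((freeCubeGroup N).g i) = x i :=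
  ⟨Monoid.CoprodI.lift fun i => involutionHom (x i) (hx i), fun i =>
    (Monoid.CoprodI.lift_of _ _).trans (involutionHom_apply (x i) (hx i))⟩

theorem halfCubeGroup_half {N : ℕ} (i j k : Fin N) :
    (halfCubeGroup N).g i * (halfCubeGroup N).g j * (halfCubeGroup N).g k =
      (halfCubeGroup N).g k * (halfCubeGroup N).g j * (halfCubeGroup N).g i :=
  mul_inv_eq_one.1 <| (QuotientGroup.eq_one_iff
    ((freeCubeGroup N).g i * (freeCubeGroup N).g j * (freeCubeGroup N).g k *
      ((freeCubeGroup N).g k * (freeCubeGroup N).g j * (freeCubeGroup N).g i)⁻¹)).2 <|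
    Subgroup.subset_normalClosure ⟨i, j, k, rfl⟩

theorem exists_halfCubeGroup_hom {N : ℕ} {H : Type*} [Group H] (x : Fin N → H)
    (hx : ∀ i, x i * x i = 1) (hh : ∀ i j k, x i * x j * x k = x k * x j * x i) :
    ∃ ρ : (halfCubeGroup N).Γ →* H, ∀ i, ρ ((halfCubeGroup N).g i) = x i := by
  obtain ⟨ρ, hρ⟩ := exists_freeCubeGroup_hom x hx
  refine ⟨QuotientGroup.lift _ ρ fun r hr => ?_, fun i => hρ i⟩
  refine (Subgroup.normalClosure_le_normal (N := ρ.ker) ?_) hr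
  rintro r ⟨i, j, k, rfl⟩
  change ρ _ = 1
  simp only [map_mul, map_inv, hρ]
  rw [hh, mul_inv_eq_one]

theorem exists_cubeGroup_hom {N : ℕ} {H : Type*} [Group H] (x : Fin N → H)
    (hx : ∀ i, x i * x i = 1) (hc : ∀ i j, x i * x j = x j * x i) :
    ∃ ρ : (cubeGroup N).Γ →* H, ∀ i, ρ ((cubeGroup N).g i) = x i := by
  refine ⟨MonoidHom.noncommPiCoprod (fun i => involutionHom (x i) (hx i)) ?_, fun i => ?_⟩
  · intro i j _ a b
    have h : ∀ (k : Fin N) z, involutionHom (x k) (hx k) z = 1 ∨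
        involutionHom (x k) (hx k) z = x k := fun k z => by
      change (if z = 1 then 1 else x k) = 1 ∨ (if z = 1 then 1 else x k) = x k
      split_ifs <;> simp
    have hc' : Commute (x i) (x j) := hc i j
    rcases h i a with h1 | h1 <;> rcases h j b with h2 | h2 <;> simp [h1, h2, hc']
  · exact (MonoidHom.noncommPiCoprod_mulSingle (fun i => involutionHom (x i) (hx i)) i _).trans
      (involutionHom_apply _ _)

theorem cubeGroup_comm {N : ℕ} (i j : Fin N) :
    (cubeGroup N).g i * (cubeGroup N).g j = (cubeGroup N).g j * (cubeGroup N).g i :=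
  mul_comm (G := Fin N → Multiplicative (ZMod 2)) _ _

/-! ### Homomorphisms out of quantum groups -/

/-- The universal property of the closed subspaces of `O_N^+` defined by relations. -/
theorem OrthogonalSubspace.exists_hom {N : ℕ} {D : Type v} [CStarAlgebra D]
    (R : Set (FreeStarAlgebra (Fin N × Fin N))) (v : Fin N → Fin N → D)
    (hs : ∀ i j, star (v i j) = v i j)
    (hr : ∀ i j, ∑ k, v i k * v j k = if i = j then 1 else 0)
    (hc : ∀ i j, ∑ k, v k i * v k j = if i = j then 1 else 0)
    (hR : ∀ r ∈ R, FreeStarAlgebra.lift (fun a : Fin N × Fin N => v a.1 a.2) r = 0) :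
    ∃ ψ : (ofRelations R).C →⋆ₐ[ℂ] D, ∀ i j, ψ ((ofRelations R).u i j) = v i j := by
  obtain ⟨ψ, hψ⟩ := CStarPres.exists_hom (orthRel N ∪ R) (fun a => v a.1 a.2) (by
    rintro r ((⟨a, rfl⟩ | ⟨i, j, rfl⟩ | ⟨i, j, rfl⟩) | h)
    · rw [map_sub, map_star, FreeStarAlgebra.lift_X, hs, sub_self]
    · rw [map_sub, map_sum]
      simp only [map_mul, FreeStarAlgebra.lift_X, hr]
      split_ifs <;> simp
    · rw [map_sub, map_sum]
      simp only [map_mul, FreeStarAlgebra.lift_X, hc]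
      split_ifs <;> simp
    · exact hR r h)
  exact ⟨ψ, fun i j => hψ (i, j)⟩

/-! ### Coefficients of elements of `A ⊗ C*(Γ)` -/

section Coefficients

variable {A : Type u} [CStarAlgebra A] {Q : Type w} [Fintype Q] [DecidableEq Q]

/-- Diagonal matrices with constant entries. -/
def constDiagonal (A : Type u) [CStarAlgebra A] (Q : Type w) [Fintype Q] [DecidableEq Q] :
    A →⋆ₐ[ℂ] CStarMatrix Q Q A where
  toFun a := CStarMatrix.ofMatrix (Matrix.diagonal fun _ => a)
  map_one' := Matrix.diagonal_one
  map_mul' a b := (Matrix.diagonal_mul_diagonal (fun _ => a) (fun _ => b)).symm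
  map_zero' := Matrix.diagonal_zero
  map_add' a b := (Matrix.diagonal_add (fun _ => a) (fun _ => b)).symm
  commutes' _ := rfl
  map_star' a := (Matrix.diagonal_conjTranspose (fun _ => a)).symm

theorem constDiagonal_apply (a : A) (x y : Q) :
    constDiagonal A Q a x y = if x = y then a else 0 :=
  Matrix.diagonal_apply _ _ _

variable [Group Q]

/-- The left regular representation of a finite group. -/
def regularRep (A : Type u) [CStarAlgebra A] (Q : Type w) [Group Q] [Fintype Q] [DecidableEq Q] :
    Q →* CStarMatrix Q Q A where
  toFun q := CStarMatrix.ofMatrix fun x y => if x = q * y then 1 else 0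
  map_one' := by
    ext x y
    rw [CStarMatrix.one_apply]
    change (if x = 1 * y then 1 else 0) = _
    rw [one_mul]
  map_mul' p q := by
    ext x y
    rw [CStarMatrix.mul_apply]
    change (if x = p * q * y then 1 else 0) =
      ∑ z, (if x = p * z then (1 : A) else 0) * (if z = q * y then 1 else 0)
    simp [mul_assoc]

theorem regularRep_apply (q x y : Q) :
    regularRep A Q q x y = if x = q * y then 1 else 0 := rfl

theorem star_regularRep (q : Q) : star (regularRep A Q q) = regularRep A Q q⁻¹ := by
  ext x y
  rw [CStarMatrix.star_apply, regularRep_apply, regularRep_apply, apply_ite star, star_one,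
    star_zero]
  refine if_congr ?_ rfl rfl
  rw [eq_inv_mul_iff_mul_eq, eq_comm]

theorem commute_constDiagonal_regularRep (a : A) (q : Q) :
    Commute (constDiagonal A Q a) (regularRep A Q q) := by
  change _ * _ = _ * _
  ext x y
  simp [CStarMatrix.mul_apply, constDiagonal_apply, regularRep_apply]

/-- Taking the coefficient at an element `q` of a finite quotient of `Γ`. -/
theorem exists_coefficient {Γ : Type v} [Group Γ] (π : Γ →* Q) (q : Q) :
    ∃ E : MaxTensor A (GroupCStar Γ) →ₗ[ℂ] A,
      ∀ a γ, E (maxTmul a (GroupCStar.of γ)) = if π γ = q then a else 0 := by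
  -- The C*-algebra structure on matrices over `A` depends on an order on `A`; the spectral order is
  -- chosen.
  let _ : PartialOrder A := CStarAlgebra.spectralOrder A
  have _ : StarOrderedRing A := CStarAlgebra.spectralOrderedRing A
  obtain ⟨ρ, hρ⟩ := GroupCStar.exists_hom ((regularRep A Q).comp π) fun γ => by
    rw [MonoidHom.comp_apply, star_regularRep, MonoidHom.comp_apply, map_inv π]
  -- The elements `b` for which `ρ b` commutes with all constant diagonal matrices form a closed
  -- *-subalgebra containing `Γ`, hence everything.
  have hc : ∀ a b, Commute (constDiagonal A Q a) (ρ b) := by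
    let S := (StarSubalgebra.centralizer ℂ (Set.range (constDiagonal A Q))).comap ρ
    have hS : ∀ b, b ∈ S ↔ ∀ a, Commute (constDiagonal A Q a) (ρ b) := fun b => by
      rw [StarSubalgebra.mem_comap, StarSubalgebra.mem_centralizer_iff]
      refine ⟨fun h a => (h _ ⟨a, rfl⟩).1, ?_⟩
      rintro h _ ⟨a, rfl⟩
      exact ⟨h a, by rw [← map_star]; exact h (star a)⟩
    have hcl : IsClosed (S : Set (GroupCStar Γ)) := by
      have h1 : (S : Set (GroupCStar Γ)) =
          ⋂ a, {b | constDiagonal A Q a * ρ b = ρ b * constDiagonal A Q a} := by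
        ext b
        rw [Set.mem_iInter]
        exact hS b
      have h2 : Continuous ρ := AddMonoidHomClass.continuous_of_bound ρ 1 fun b =>
        (NonUnitalStarAlgHom.norm_apply_le ρ b).trans (one_mul _).ge
      rw [h1]
      exact isClosed_iInter fun a =>
        isClosed_eq (continuous_const.mul h2) (h2.mul continuous_const)
    have htop : S.topologicalClosure = ⊤ := CStarPres.closure_eq_top (groupRel Γ) S fun γ =>
      (hS _).2 fun a => by
        have h := commute_constDiagonal_regularRep a (π γ)
        rwa [← MonoidHom.comp_apply, ← hρ] at h
    intro a b
    refine (hS b).1 ?_ a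
    have hb : b ∈ S.topologicalClosure := htop ▸ trivial
    exact hcl.closure_subset hb
  obtain ⟨ψ, hψ⟩ := MaxTensor.exists_hom (constDiagonal A Q) ρ hc
  -- The matrix of left translation by `π γ` has entry `1` at `(q, 1)` exactly when `π γ = q`.
  refine ⟨{ toFun := fun t => ψ t q 1
            map_add' := fun s t => by rw [map_add]; rfl
            map_smul' := fun c t => by rw [map_smul]; rfl }, fun a γ => ?_⟩
  change ψ (maxTmul a (GroupCStar.of γ)) q 1 = _
  rw [hψ, hρ, CStarMatrix.mul_apply]
  simp [constDiagonal_apply, regularRep_apply, eq_comm]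

end Coefficients

/-- Two *-homomorphisms out of a free *-algebra which agree on the generators are equal. -/
theorem FreeStarAlgebra.lift_comp_X {ι : Type u} {D : Type v} [Ring D] [StarRing D] [Algebra ℂ D]
    [StarModule ℂ D] (φ : FreeStarAlgebra ι →⋆ₐ[ℂ] D) (f : FreeStarAlgebra ι) :
    lift (fun i => φ (X i)) f = φ f :=
  mem_of_X_mem (StarAlgHom.equalizer (lift fun i => φ (X i)) φ) (fun i => lift_X _ i) f

theorem OrthogonalSubspace.lift_u_eq_zero {N : ℕ} {R : Set (FreeStarAlgebra (Fin N × Fin N))}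
    {r : FreeStarAlgebra (Fin N × Fin N)} (hr : r ∈ R) :
    FreeStarAlgebra.lift (fun a : Fin N × Fin N => (ofRelations R).u a.1 a.2) r = 0 :=
  (FreeStarAlgebra.lift_comp_X (CStarPres.mk (orthRel N ∪ R)) r).trans
    (CStarPres.mk_eq_zero _ (Or.inr hr))

/-! ### Relations between the entries of a matrix -/

section MatrixRelations

variable {N : ℕ} {D : Type u}

/-- Entries on the same row or column anticommute, all the other pairs commute. -/
structure IsTwisted [Ring D] (v : Fin N → Fin N → D) : Prop where
  row : ∀ i {j l}, j ≠ l → v i j * v i l = -(v i l * v i j)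
  col : ∀ {i k} j, i ≠ k → v i j * v k j = -(v k j * v i j)
  comm : ∀ {i k j l}, i ≠ k → j ≠ l → v i j * v k l = v k l * v i j

/-- Entries on the same row or column have product zero. -/
structure IsCubic [Ring D] (v : Fin N → Fin N → D) : Prop where
  row : ∀ i {j l}, j ≠ l → v i j * v i l = 0
  col : ∀ {i k} j, i ≠ k → v i j * v k j = 0

/-- The entries half-commute. -/
def IsHalfCommuting [Ring D] (v : Fin N → Fin N → D) : Prop :=
  ∀ i j k a b c, v i a * v j b * v k c = v k c * v j b * v i a

/-- The entries are self-adjoint, and the matrix is orthogonal. -/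
structure IsOrthogonal [Ring D] [StarRing D] (v : Fin N → Fin N → D) : Prop where
  star_eq : ∀ i j, star (v i j) = v i j
  row : ∀ i j, ∑ k, v i k * v j k = if i = j then 1 else 0
  col : ∀ i j, ∑ k, v k i * v k j = if i = j then 1 else 0

theorem OrthogonalSubspace.isOrthogonal (G : OrthogonalSubspace.{u} N) : IsOrthogonal G.u :=
  ⟨G.star_u, G.row, G.col⟩

variable [CStarAlgebra D] {v : Fin N → Fin N → D}

open FreeStarAlgebra (X lift)

/-- A dictionary between relators on pairs of indices and relations with explicit rows and columns.
One direction reads the relations off the universal coordinates, the other feeds the universal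
property. The next two equivalences play the same role. -/
theorem isTwisted_iff : IsTwisted v ↔ ∀ r ∈ {r | ∃ a b : Fin N × Fin N,
    (a ≠ b ∧ (a.1 = b.1 ∨ a.2 = b.2) ∧ r = X a * X b - -(X b * X a)) ∨
    (¬ (a ≠ b ∧ (a.1 = b.1 ∨ a.2 = b.2)) ∧ r = X a * X b - X b * X a)},
    lift (fun a : Fin N × Fin N => v a.1 a.2) r = 0 := by
  constructor
  · rintro h r ⟨⟨i, j⟩, ⟨k, l⟩, ⟨h1, h2, rfl⟩ | ⟨h1, rfl⟩⟩
    · simp only [map_sub, map_neg, map_mul, FreeStarAlgebra.lift_X, sub_eq_zero]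
      by_cases hik : i = k
      · subst hik
        exact h.row i fun hjl => h1 (by rw [hjl])
      · obtain rfl : j = l := h2.resolve_left hik
        exact h.col j hik
    · simp only [map_sub, map_mul, FreeStarAlgebra.lift_X, sub_eq_zero]
      by_cases hik : i = k
      · by_cases hjl : j = l
        · rw [hik, hjl]
        · exact absurd ⟨fun e => hjl (congrArg Prod.snd e), Or.inl hik⟩ h1
      · by_cases hjl : j = l
        · exact absurd ⟨fun e => hik (congrArg Prod.fst e), Or.inr hjl⟩ h1
        · exact h.comm hik hjl
  · intro h
    refine ⟨fun i j l hjl => ?_, fun {i k} j hik => ?_, fun {i k j l} hik hjl => ?_⟩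
    · simpa only [map_sub, map_neg, map_mul, FreeStarAlgebra.lift_X, sub_eq_zero] using
        h _ ⟨(i, j), (i, l), Or.inl ⟨fun e => hjl (congrArg Prod.snd e), Or.inl rfl, rfl⟩⟩
    · simpa only [map_sub, map_neg, map_mul, FreeStarAlgebra.lift_X, sub_eq_zero] using
        h _ ⟨(i, j), (k, j), Or.inl ⟨fun e => hik (congrArg Prod.fst e), Or.inr rfl, rfl⟩⟩
    · simpa only [map_sub, map_mul, FreeStarAlgebra.lift_X, sub_eq_zero] using
        h _ ⟨(i, j), (k, l), Or.inr ⟨fun e => e.2.elim hik hjl, rfl⟩⟩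

theorem isCubic_iff : IsCubic v ↔ ∀ r ∈ OrthogonalSubspace.cubicRel N,
    lift (fun a : Fin N × Fin N => v a.1 a.2) r = 0 := by
  constructor
  · rintro h r ⟨⟨i, j⟩, ⟨k, l⟩, h1, h2, rfl⟩
    simp only [map_mul, FreeStarAlgebra.lift_X]
    by_cases hik : i = k
    · subst hik
      exact h.row i fun hjl => h1 (by rw [hjl])
    · obtain rfl : j = l := h2.resolve_left hik
      exact h.col j hik
  · intro h
    refine ⟨fun i j l hjl => ?_, fun {i k} j hik => ?_⟩
    · simpa only [map_mul, FreeStarAlgebra.lift_X] using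
        h _ ⟨(i, j), (i, l), fun e => hjl (congrArg Prod.snd e), Or.inl rfl, rfl⟩
    · simpa only [map_mul, FreeStarAlgebra.lift_X] using
        h _ ⟨(i, j), (k, j), fun e => hik (congrArg Prod.fst e), Or.inr rfl, rfl⟩

theorem isCubic_and_isHalfCommuting_iff : IsCubic v ∧ IsHalfCommuting v ↔
    ∀ r ∈ OrthogonalSubspace.cubicRel N ∪
      {r | ∃ a b c : Fin N × Fin N, r = X a * X b * X c - X c * X b * X a},
    lift (fun a : Fin N × Fin N => v a.1 a.2) r = 0 := by
  rw [isCubic_iff]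
  constructor
  · rintro ⟨h1, h2⟩ r (hr | ⟨a, b, c, rfl⟩)
    · exact h1 r hr
    · simp only [map_sub, map_mul, FreeStarAlgebra.lift_X, sub_eq_zero]
      exact h2 _ _ _ _ _ _
  · refine fun h => ⟨fun r hr => h r (Or.inl hr), fun i j k a b c => ?_⟩
    simpa only [map_sub, map_mul, FreeStarAlgebra.lift_X, sub_eq_zero] using
      h _ (Or.inr ⟨(i, a), (j, b), (k, c), rfl⟩)

end MatrixRelations

/-! ### Universal properties of the three quantum groups. -/

namespace OrthogonalSubspace

variable {N : ℕ} {D : Type u} [CStarAlgebra D] {v : Fin N → Fin N → D}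

theorem isTwisted_twistedO : IsTwisted (twistedO N).u :=
  isTwisted_iff.2 fun _ => lift_u_eq_zero

theorem isCubic_freeH : IsCubic (freeH N).u :=
  isCubic_iff.2 fun _ => lift_u_eq_zero

theorem isCubic_halfH : IsCubic (halfH N).u :=
  (isCubic_and_isHalfCommuting_iff.2 fun _ => lift_u_eq_zero).1

theorem isHalfCommuting_halfH : IsHalfCommuting (halfH N).u :=
  (isCubic_and_isHalfCommuting_iff.2 fun _ => lift_u_eq_zero).2

theorem exists_twistedO_hom (h : IsOrthogonal v) (ht : IsTwisted v) :
    ∃ ψ : (twistedO N).C →⋆ₐ[ℂ] D, ∀ i j, ψ ((twistedO N).u i j) = v i j :=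
  exists_hom _ v h.star_eq h.row h.col (isTwisted_iff.1 ht)

theorem exists_freeH_hom (h : IsOrthogonal v) (hc : IsCubic v) :
    ∃ ψ : (freeH N).C →⋆ₐ[ℂ] D, ∀ i j, ψ ((freeH N).u i j) = v i j :=
  exists_hom _ v h.star_eq h.row h.col (isCubic_iff.1 hc)

theorem exists_halfH_hom (h : IsOrthogonal v) (hc : IsCubic v) (hh : IsHalfCommuting v) :
    ∃ ψ : (halfH N).C →⋆ₐ[ℂ] D, ∀ i j, ψ ((halfH N).u i j) = v i j :=
  exists_hom _ v h.star_eq h.row h.col (isCubic_and_isHalfCommuting_iff.1 ⟨hc, hh⟩)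

end OrthogonalSubspace

/-! ### Sums of elementary tensors -/

section SumTmul

variable {N : ℕ} {A : Type u} {B : Type v} [CStarAlgebra A] [CStarAlgebra B]

/-- The element `∑ a_j ⊗ b_j`. -/
noncomputable def sumTmul (a : Fin N → A) (b : Fin N → B) : MaxTensor A B :=
  ∑ j, maxTmul (a j) (b j)

variable (a a' a'' : Fin N → A) (b b' b'' : Fin N → B)

theorem star_sumTmul (ha : ∀ i, star (a i) = a i) (hb : ∀ i, star (b i) = b i) :
    star (sumTmul a b) = sumTmul a b := by
  rw [sumTmul, star_sum]
  simp only [star_maxTmul, ha, hb]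

theorem sumTmul_mul : sumTmul a b * sumTmul a' b' =
    ∑ i, ∑ j, maxTmul (a i * a' j) (b i * b' j) := by
  simp only [sumTmul, Finset.sum_mul_sum, maxTmul_mul]

/-- Exchanging the summation indices lets a product and its reverse be compared term by term;
`sumTmul_mul_mul'` does the same for three factors. -/
theorem sumTmul_mul' : sumTmul a b * sumTmul a' b' =
    ∑ i, ∑ j, maxTmul (a j * a' i) (b j * b' i) := by
  rw [sumTmul_mul, Finset.sum_comm]

theorem sumTmul_mul_mul : sumTmul a b * sumTmul a' b' * sumTmul a'' b'' =
    ∑ i, ∑ j, ∑ k, maxTmul (a i * a' j * a'' k) (b i * b' j * b'' k) := by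
  rw [sumTmul_mul]
  simp only [Finset.sum_mul]
  simp only [sumTmul, Finset.mul_sum, maxTmul_mul]

theorem sumTmul_mul_mul' : sumTmul a b * sumTmul a' b' * sumTmul a'' b'' =
    ∑ i, ∑ j, ∑ k, maxTmul (a k * a' j * a'' i) (b k * b' j * b'' i) := by
  rw [sumTmul_mul_mul]
  refine (Finset.sum_congr rfl fun _ _ => Finset.sum_comm).trans ?_
  exact Finset.sum_comm.trans (Finset.sum_congr rfl fun _ _ => Finset.sum_comm)

variable {a a' a'' b b' b''}

theorem sumTmul_half (h : ∀ i j k, a i * a' j * a'' k = a'' k * a' j * a i)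
    (h' : ∀ i j k, b i * b' j * b'' k = b'' k * b' j * b i) :
    sumTmul a b * sumTmul a' b' * sumTmul a'' b'' =
      sumTmul a'' b'' * sumTmul a' b' * sumTmul a b := by
  rw [sumTmul_mul_mul, sumTmul_mul_mul']
  simp only [h, h']

theorem sumTmul_comm (h : ∀ i j, maxTmul (a i * a' j) (b i * b' j) =
    maxTmul (a' j * a i) (b' j * b i)) :
    sumTmul a b * sumTmul a' b' = sumTmul a' b' * sumTmul a b := by
  rw [sumTmul_mul, sumTmul_mul']
  simp only [h]

theorem sumTmul_anticomm (h : ∀ i j, maxTmul (a i * a' j) (b i * b' j) =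
    -maxTmul (a' j * a i) (b' j * b i)) :
    sumTmul a b * sumTmul a' b' = -(sumTmul a' b' * sumTmul a b) := by
  rw [sumTmul_mul, sumTmul_mul']
  simp only [h, Finset.sum_neg_distrib]

theorem sumTmul_mul_eq_sum (h : ∀ i j, i ≠ j → maxTmul (a i * a' j) (b i * b' j) = 0) :
    sumTmul a b * sumTmul a' b' = ∑ i, maxTmul (a i * a' i) (b i * b' i) := by
  rw [sumTmul_mul]
  refine Finset.sum_congr rfl fun i _ => Finset.sum_eq_single i (fun j _ hj => h i j hj.symm) ?_
  simp

/-- Removes the normalisation `1/√N` of the coordinates from the definition of an affine action. -/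
theorem map_smul_eq_sum_maxTmul_iff {c : ℂ} (hc : c ≠ 0) (Φ : B →⋆ₐ[ℂ] MaxTensor A B) (y : B)
    (a : Fin N → A) (b : Fin N → B) :
    Φ (c • y) = ∑ j, maxTmul (a j) (c • b j) ↔ Φ y = sumTmul a b := by
  rw [map_smul]
  simp only [maxTmul_smul, ← Finset.smul_sum]
  exact smul_right_inj hc

end SumTmul

/-! ### Comultiplication -/

section Comultiplication

variable {N : ℕ} {A : Type u} {B : Type v} [CStarAlgebra A] [CStarAlgebra B]
  {s : Fin N → Fin N → A} {t : Fin N → Fin N → B}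

/-- The product of two matrices, with entries in the tensor product. -/
noncomputable def tensorMatrix (s : Fin N → Fin N → A) (t : Fin N → Fin N → B) (i j : Fin N) :
    MaxTensor A B :=
  sumTmul (s i) fun k => t k j

theorem IsOrthogonal.tensorMatrix (hs : IsOrthogonal s) (ht : IsOrthogonal t) :
    IsOrthogonal (tensorMatrix s t) where
  star_eq i j := star_sumTmul _ _ (hs.star_eq i) fun k => ht.star_eq k j
  row i j := by
    simp only [NCCube.tensorMatrix, sumTmul_mul]
    -- The sum over the common column index is evaluated before the others: it yields a Kronecker
    -- delta by orthogonality of the rows of `t`, and the rows of `s` do the rest.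
    rw [Finset.sum_comm]
    simp only [Finset.sum_comm (s := Finset.univ (α := Fin N)) (f := fun k l => maxTmul _ (t _ k * t l k)),
      ← maxTmul_sum, ht.row]
    simp only [apply_ite (maxTmul _), maxTmul_zero, Finset.sum_ite_eq, Finset.mem_univ, if_true,
      ← sum_maxTmul, hs.row]
    split_ifs
    · exact maxTmul_one_one
    · exact zero_maxTmul _
  col i j := by
    simp only [NCCube.tensorMatrix, sumTmul_mul]
    rw [Finset.sum_comm]
    have h : ∀ l, ∑ k, ∑ m, maxTmul (s k l * s k m) (t l i * t m j) =
        maxTmul 1 (t l i * t l j) := fun l => by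
      rw [Finset.sum_comm]
      simp only [← sum_maxTmul, hs.col]
      rw [Finset.sum_eq_single l]
      · rw [if_pos rfl]
      · exact fun m _ hm => by rw [if_neg hm.symm, zero_maxTmul]
      · exact fun h => absurd (Finset.mem_univ l) h
    simp only [h, ← maxTmul_sum, ht.col]
    split_ifs
    · exact maxTmul_one_one
    · exact maxTmul_zero _

/-- For two entries on the same row, the mixed terms die in the left factor and the diagonal ones in
the right factor; for a column the roles are exchanged. -/
theorem IsCubic.tensorMatrix (hs : IsCubic s) (ht : IsCubic t) :
    IsCubic (tensorMatrix s t) where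
  row i j l hjl := by
    rw [NCCube.tensorMatrix, NCCube.tensorMatrix,
      sumTmul_mul_eq_sum fun k m hkm => by rw [hs.row i hkm, zero_maxTmul]]
    exact Finset.sum_eq_zero fun k _ => by rw [ht.row k hjl, maxTmul_zero]
  col {i k} j hik := by
    rw [NCCube.tensorMatrix, NCCube.tensorMatrix,
      sumTmul_mul_eq_sum fun l m hlm => by rw [ht.col j hlm, maxTmul_zero]]
    exact Finset.sum_eq_zero fun l _ => by rw [hs.col l hik, zero_maxTmul]

theorem IsHalfCommuting.tensorMatrix (hs : IsHalfCommuting s) (ht : IsHalfCommuting t) :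
    IsHalfCommuting (tensorMatrix s t) := fun _ _ _ _ _ _ =>
  sumTmul_half (fun _ _ _ => hs _ _ _ _ _ _) fun _ _ _ => ht _ _ _ _ _ _

/-- A count of signs. On a common row or column exactly one of the two tensor factors anticommutes
in each term. For different rows and columns, both anticommute when the summation indices agree and
both commute otherwise. -/
theorem IsTwisted.tensorMatrix (hs : IsTwisted s) (ht : IsTwisted t) :
    IsTwisted (tensorMatrix s t) where
  row i j l hjl := sumTmul_anticomm fun k m => by
    by_cases hkm : k = m
    · rw [hkm, ht.row m hjl, maxTmul_neg]
    · rw [hs.row i hkm, ht.comm hkm hjl, neg_maxTmul]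
  col {i k} j hik := sumTmul_anticomm fun l m => by
    by_cases hlm : l = m
    · rw [hlm, hs.col m hik, neg_maxTmul]
    · rw [ht.col j hlm, hs.comm hik hlm, maxTmul_neg]
  comm {i k j l} hik hjl := sumTmul_comm fun m n => by
    by_cases hmn : m = n
    · rw [hmn, hs.col n hik, ht.row n hjl, neg_maxTmul, maxTmul_neg, neg_neg]
    · rw [hs.comm hik hmn, ht.comm hmn hjl]

end Comultiplication

/-! ### Counit and antipode -/

section CounitAntipode

open MulOpposite (op)

variable {N : ℕ} {D : Type u} {v : Fin N → Fin N → D}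

theorem isOrthogonal_one [Ring D] [StarRing D] :
    IsOrthogonal fun i j : Fin N => if i = j then (1 : D) else 0 where
  star_eq i j := by split_ifs <;> simp
  row i j := by simp
  col i j := by simp [eq_comm]

theorem isCubic_one [Ring D] : IsCubic fun i j : Fin N => if i = j then (1 : D) else 0 where
  row i j l h := by
    by_cases hj : i = j
    · simp [hj, h]
    · simp [hj]
  col {i k} j h := by
    by_cases hi : i = j
    · simp [← hi, h.symm]
    · simp [hi]

/-- Vanishing products anticommute trivially; this supplies the counit of the twisted group from the
identity matrix over `ℂ`. -/
theorem IsCubic.isTwisted [CommRing D] (h : IsCubic v) : IsTwisted v where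
  row i _ _ hjl := by rw [h.row i hjl, h.row i hjl.symm, neg_zero]
  col j hik := by rw [h.col j hik, h.col j hik.symm, neg_zero]
  comm _ _ := mul_comm _ _

theorem isHalfCommuting_of_comm [CommRing D] (v : Fin N → Fin N → D) : IsHalfCommuting v :=
  fun _ _ _ _ _ _ => by ring

theorem IsOrthogonal.op [Ring D] [StarRing D] (h : IsOrthogonal v) :
    IsOrthogonal fun i j => op (v j i) where
  star_eq i j := by rw [← MulOpposite.op_star, h.star_eq]
  row i j := by
    simp only [← MulOpposite.op_mul, ← Finset.op_sum, h.col, eq_comm (a := j)]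
    split_ifs <;> simp
  col i j := by
    simp only [← MulOpposite.op_mul, ← Finset.op_sum, h.row, eq_comm (a := j)]
    split_ifs <;> simp

theorem IsCubic.op [Ring D] (h : IsCubic v) : IsCubic fun i j => op (v j i) where
  row i _ _ hjl := by rw [← MulOpposite.op_mul, h.col i hjl.symm, MulOpposite.op_zero]
  col j hik := by rw [← MulOpposite.op_mul, h.row j hik.symm, MulOpposite.op_zero]

theorem IsTwisted.op [Ring D] (h : IsTwisted v) : IsTwisted fun i j => op (v j i) where
  row i _ _ hjl := by
    rw [← MulOpposite.op_mul, h.col i hjl.symm, MulOpposite.op_neg, MulOpposite.op_mul]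
  col j hik := by
    rw [← MulOpposite.op_mul, h.row j hik.symm, MulOpposite.op_neg, MulOpposite.op_mul]
  comm hik hjl := by rw [← MulOpposite.op_mul, ← MulOpposite.op_mul, h.comm hjl hik]

theorem IsHalfCommuting.op [Ring D] (h : IsHalfCommuting v) :
    IsHalfCommuting fun i j => op (v j i) := fun i j k a b c => by
  simp only [← MulOpposite.op_mul, ← mul_assoc]
  rw [h]

end CounitAntipode

namespace OrthogonalSubspace

variable (N : ℕ)

/-- The comultiplication, counit and antipode come from the universal property, applied to the
product matrix, to the identity matrix and to the transpose in the opposite algebra. -/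
theorem isQuantumGroup_twistedO : (twistedO N).IsQuantumGroup :=
  ⟨exists_twistedO_hom ((isOrthogonal _).tensorMatrix (isOrthogonal _))
      (isTwisted_twistedO.tensorMatrix isTwisted_twistedO),
    exists_twistedO_hom isOrthogonal_one isCubic_one.isTwisted,
    exists_twistedO_hom (isOrthogonal _).op isTwisted_twistedO.op⟩

theorem isQuantumGroup_freeH : (freeH N).IsQuantumGroup :=
  ⟨exists_freeH_hom ((isOrthogonal _).tensorMatrix (isOrthogonal _))
      (isCubic_freeH.tensorMatrix isCubic_freeH),
    exists_freeH_hom isOrthogonal_one isCubic_one,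
    exists_freeH_hom (isOrthogonal _).op isCubic_freeH.op⟩

theorem isQuantumGroup_halfH : (halfH N).IsQuantumGroup :=
  ⟨exists_halfH_hom ((isOrthogonal _).tensorMatrix (isOrthogonal _))
      (isCubic_halfH.tensorMatrix isCubic_halfH)
      (isHalfCommuting_halfH.tensorMatrix isHalfCommuting_halfH),
    exists_halfH_hom isOrthogonal_one isCubic_one (isHalfCommuting_of_comm _),
    exists_halfH_hom (isOrthogonal _).op isCubic_halfH.op isHalfCommuting_halfH.op⟩

/-! ### Affine actions on cubes -/

variable {N} {G : OrthogonalSubspace.{v} N} {S : ReflectionGroup.{u} N}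

theorem actsAffinely_cube_iff [NeZero N] : G.ActsAffinely S.cube ↔
    ∃ Φ : GroupCStar S.Γ →⋆ₐ[ℂ] MaxTensor G.C (GroupCStar S.Γ),
      ∀ i, Φ (GroupCStar.of (S.g i)) = sumTmul (G.u i) fun j => GroupCStar.of (S.g j) := by
  have hN : ((√(N : ℝ) : ℝ) : ℂ)⁻¹ ≠ 0 := by
    rw [ne_eq, inv_eq_zero, Complex.ofReal_eq_zero, Real.sqrt_eq_zero (Nat.cast_nonneg N)]
    exact Nat.cast_ne_zero.2 (NeZero.ne N)
  refine exists_congr fun Φ => forall_congr' fun i => ?_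
  exact map_smul_eq_sum_maxTmul_iff hN Φ _ _ _

theorem star_sumTmul_of (G : OrthogonalSubspace.{v} N) (S : ReflectionGroup.{u} N) (i : Fin N) :
    star (sumTmul (G.u i) fun j => GroupCStar.of (S.g j)) =
      sumTmul (G.u i) fun j => GroupCStar.of (S.g j) :=
  star_sumTmul _ _ (G.star_u i) fun j => by
    rw [GroupCStar.star_of, inv_eq_of_mul_eq_one_left (S.sq j)]

/-- A `y i` with square `1` is a unit equal to its own inverse, so the universal property of `Γ`
applies with the unit group as target. Self-adjointness of the `y i` extends the representation to
`C*(Γ)`. -/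
theorem actsAffinely_of_hom [NeZero N]
    (h2 : ∀ i, (sumTmul (G.u i) fun j => GroupCStar.of (S.g j)) *
      (sumTmul (G.u i) fun j => GroupCStar.of (S.g j)) = 1)
    (h : ∃ ρ : S.Γ →* (MaxTensor G.C (GroupCStar S.Γ))ˣ,
      ∀ i, ρ (S.g i) = ⟨_, _, h2 i, h2 i⟩) :
    G.ActsAffinely S.cube := by
  obtain ⟨ρ, hρ⟩ := h
  obtain ⟨Φ, hΦ⟩ := S.exists_hom ρ fun i => by rw [hρ]; exact star_sumTmul_of G S i
  exact actsAffinely_cube_iff.2 ⟨Φ, fun i => by rw [hΦ, hρ]⟩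

theorem sumTmul_of_sq_of_isCubic (S : ReflectionGroup.{u} N) (hG : IsCubic G.u) (i : Fin N) :
    (sumTmul (G.u i) fun j => GroupCStar.of (S.g j)) *
      (sumTmul (G.u i) fun j => GroupCStar.of (S.g j)) = 1 := by
  rw [sumTmul_mul_eq_sum fun j k hjk => by rw [hG.row i hjk, zero_maxTmul]]
  simp only [← map_mul, S.sq, ← sum_maxTmul, G.row, if_true, map_one, maxTmul_one_one]

theorem actsAffinely_freeH [NeZero N] : (freeH N).ActsAffinely (freeCubeGroup N).cube :=
  actsAffinely_of_hom (sumTmul_of_sq_of_isCubic _ isCubic_freeH) <|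
    exists_freeCubeGroup_hom _ fun i => Units.ext (sumTmul_of_sq_of_isCubic _ isCubic_freeH i)

theorem actsAffinely_halfH [NeZero N] : (halfH N).ActsAffinely (halfCubeGroup N).cube :=
  actsAffinely_of_hom (sumTmul_of_sq_of_isCubic _ isCubic_halfH) <|
    exists_halfCubeGroup_hom _
      (fun i => Units.ext (sumTmul_of_sq_of_isCubic _ isCubic_halfH i))
      fun i j k => Units.ext <| sumTmul_half (fun a b c => isHalfCommuting_halfH i j k a b c)
        fun a b c => by simp only [← map_mul, halfCubeGroup_half a b c]

theorem sumTmul_of_sq_of_isTwisted (hG : IsTwisted G.u)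
    (hS : ∀ a b, S.g a * S.g b = S.g b * S.g a) (i : Fin N) :
    (sumTmul (G.u i) fun j => GroupCStar.of (S.g j)) *
      (sumTmul (G.u i) fun j => GroupCStar.of (S.g j)) = 1 := by
  set y := sumTmul (G.u i) fun j => (GroupCStar.of (S.g j) : GroupCStar S.Γ)
  -- Doubling the sum pairs the term `(a, b)` with `(b, a)`: the group parts are equal and the
  -- anticommuting coefficients cancel, without ordering the indices.
  have h : y * y + y * y = (2 : ℂ) • 1 := by
    refine (congrArg₂ (· + ·) (sumTmul_mul _ _ _ _) (sumTmul_mul' _ _ _ _)).trans ?_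
    simp only [← Finset.sum_add_distrib]
    have h1 : ∀ a b, maxTmul (G.u i a * G.u i b)
          ((GroupCStar.of (S.g a) : GroupCStar S.Γ) * GroupCStar.of (S.g b)) +
        maxTmul (G.u i b * G.u i a)
          ((GroupCStar.of (S.g b) : GroupCStar S.Γ) * GroupCStar.of (S.g a)) =
        if a = b then (2 : ℂ) • maxTmul (G.u i a * G.u i a) 1 else 0 := fun a b => by
      split_ifs with hab
      · rw [← hab, ← map_mul, S.sq, map_one, two_smul]
      · rw [← map_mul, ← map_mul, hS a b, hG.row i hab, neg_maxTmul, neg_add_cancel]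
    simp only [h1, Finset.sum_ite_eq, Finset.mem_univ, if_true, ← Finset.smul_sum, ← sum_maxTmul,
      G.row, maxTmul_one_one]
  rw [← two_smul ℂ] at h
  exact (smul_right_inj two_ne_zero).1 h

/-- Mixed terms cancel individually, since their entries lie on different rows and columns. The
terms with `a = b` do not cancel one by one: their total vanishes by orthogonality of rows `i` and
`j`. -/
theorem sumTmul_of_comm_of_isTwisted (hG : IsTwisted G.u)
    (hS : ∀ a b, S.g a * S.g b = S.g b * S.g a) {i j : Fin N} (hij : i ≠ j) :
    (sumTmul (G.u i) fun j => (GroupCStar.of (S.g j) : GroupCStar S.Γ)) *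
      (sumTmul (G.u j) fun j => GroupCStar.of (S.g j)) =
    (sumTmul (G.u j) fun j => GroupCStar.of (S.g j)) *
      (sumTmul (G.u i) fun j => GroupCStar.of (S.g j)) := by
  rw [← sub_eq_zero, sumTmul_mul, sumTmul_mul']
  simp only [← Finset.sum_sub_distrib]
  have h1 : ∀ a b, maxTmul (G.u i a * G.u j b)
        ((GroupCStar.of (S.g a) : GroupCStar S.Γ) * GroupCStar.of (S.g b)) -
      maxTmul (G.u j b * G.u i a)
        ((GroupCStar.of (S.g b) : GroupCStar S.Γ) * GroupCStar.of (S.g a)) =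
      if a = b then maxTmul (G.u i a * G.u j a - G.u j a * G.u i a) 1 else 0 := fun a b => by
    split_ifs with hab
    · rw [← hab, ← map_mul, S.sq, map_one, sub_maxTmul]
    · rw [← map_mul, ← map_mul, hS a b, hG.comm hij hab, sub_self]
  simp only [h1, Finset.sum_ite_eq, Finset.mem_univ, if_true, ← sum_maxTmul,
    Finset.sum_sub_distrib, G.row, if_neg hij, if_neg hij.symm, sub_self, zero_maxTmul]

theorem actsAffinely_twistedO [NeZero N] : (twistedO N).ActsAffinely (cubeGroup N).cube :=
  actsAffinely_of_hom (sumTmul_of_sq_of_isTwisted isTwisted_twistedO cubeGroup_comm) <|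
    exists_cubeGroup_hom _
      (fun i => Units.ext (sumTmul_of_sq_of_isTwisted isTwisted_twistedO cubeGroup_comm i))
      fun i j => by
        by_cases hij : i = j
        · rw [hij]
        · exact Units.ext (sumTmul_of_comm_of_isTwisted isTwisted_twistedO cubeGroup_comm hij)

end OrthogonalSubspace

/-! ### Maximality -/

/-- A product of three reflections is the reflection with exponent `x - y + z`, which is symmetric
in the outer ones. The exponents used below lie in `{-1, 0, 1}`, so the alternating sums of three
lie between `-3` and `3` and stay distinct modulo `7`. -/
theorem exists_halfCubeGroup_dihedral {N : ℕ} (e : Fin N → ZMod 7) :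
    ∃ π : (halfCubeGroup N).Γ →* DihedralGroup 7,
      ∀ i, π ((halfCubeGroup N).g i) = DihedralGroup.sr (e i) :=
  exists_halfCubeGroup_hom _ (fun i => by simp) fun i j k => by
    simp only [DihedralGroup.sr_mul_sr, DihedralGroup.r_mul_sr]
    congr 1
    ring

theorem exists_freeCubeGroup_dihedral {N : ℕ} (e : Fin N → ZMod 7) :
    ∃ π : (freeCubeGroup N).Γ →* DihedralGroup 7,
      ∀ i, π ((freeCubeGroup N).g i) = DihedralGroup.sr (e i) :=
  exists_freeCubeGroup_hom _ fun i => by simp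

/-- A homomorphism from `ℤ₂^N` onto the square of `ℤ₂`, given by two of the coordinates. -/
theorem exists_cubeGroup_square {N : ℕ} (a b : Fin N) :
    ∃ π : (cubeGroup N).Γ →* Multiplicative (ZMod 2) × Multiplicative (ZMod 2),
      ∀ i, π ((cubeGroup N).g i) = (if i = a then Multiplicative.ofAdd 1 else 1,
        if i = b then Multiplicative.ofAdd 1 else 1) :=
  exists_cubeGroup_hom _
    (fun i => (by decide : ∀ x : Multiplicative (ZMod 2) × Multiplicative (ZMod 2), x * x = 1) _)
    fun i j => mul_comm _ _

namespace OrthogonalSubspace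

variable {N : ℕ} {G : OrthogonalSubspace.{v} N} {S : ReflectionGroup.{u} N}

theorem IsQuantumGroup.antipode (hG : G.IsQuantumGroup) :
    ∃ κ : G.C →⋆ₐ[ℂ] (G.C)ᵐᵒᵖ, ∀ i j, κ (G.u i j) = MulOpposite.op (G.u j i) := hG.2.2

/-- The antipode transposes `u` and reverses products, hence turns row relations into column
relations. -/
theorem IsQuantumGroup.isCubic_of_row (hG : G.IsQuantumGroup)
    (h : ∀ i {j l}, j ≠ l → G.u i j * G.u i l = 0) : IsCubic G.u where
  row := h
  col {i k} j hik := by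
    obtain ⟨κ, hκ⟩ := hG.antipode
    have h1 := congrArg κ (h j hik.symm)
    rw [map_mul, hκ, hκ, ← MulOpposite.op_mul, map_zero] at h1
    exact MulOpposite.op_injective h1

section Action

variable {Φ : GroupCStar S.Γ →⋆ₐ[ℂ] MaxTensor G.C (GroupCStar S.Γ)}
  {Q : Type w} [Group Q] [Fintype Q] [DecidableEq Q]

/-- The coefficients of the square of the image of a generator under an affine action. -/
theorem coefficient_sq
    (hΦ : ∀ i, Φ (GroupCStar.of (S.g i)) = sumTmul (G.u i) fun j => GroupCStar.of (S.g j))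
    (π : S.Γ →* Q) (q : Q) (hq : q ≠ 1) (i : Fin N) :
    (∑ x, ∑ y, if π (S.g x) * π (S.g y) = q then G.u i x * G.u i y else 0) = 0 := by
  obtain ⟨E, hE⟩ := exists_coefficient (A := G.C) π q
  have h : Φ (GroupCStar.of (S.g i)) * Φ (GroupCStar.of (S.g i)) =
      maxTmul 1 (GroupCStar.of 1) := by
    rw [← map_mul, ← map_mul, S.sq, map_one, map_one, maxTmul_one_one]
  rw [hΦ, sumTmul_mul] at h
  have h1 := congrArg E h
  rw [hE, map_one, if_neg hq.symm] at h1
  simpa only [← map_mul, map_sum, hE] using h1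

/-- The coefficients of the product of the images of two commuting generators. -/
theorem coefficient_comm
    (hΦ : ∀ i, Φ (GroupCStar.of (S.g i)) = sumTmul (G.u i) fun j => GroupCStar.of (S.g j))
    (π : S.Γ →* Q) (q : Q) {i j : Fin N} (h : S.g i * S.g j = S.g j * S.g i) :
    (∑ x, ∑ y, if π (S.g x) * π (S.g y) = q then G.u i x * G.u j y else 0) =
      ∑ x, ∑ y, if π (S.g x) * π (S.g y) = q then G.u j x * G.u i y else 0 := by
  obtain ⟨E, hE⟩ := exists_coefficient (A := G.C) π q
  have h : Φ (GroupCStar.of (S.g i)) * Φ (GroupCStar.of (S.g j)) =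
      Φ (GroupCStar.of (S.g j)) * Φ (GroupCStar.of (S.g i)) := by
    rw [← map_mul, ← map_mul, h, map_mul, map_mul]
  rw [hΦ, hΦ, sumTmul_mul, sumTmul_mul] at h
  have h1 := congrArg E h
  simpa only [← map_mul, map_sum, hE] using h1

/-- The coefficients of the product of the images of three half-commuting generators. -/
theorem coefficient_half
    (hΦ : ∀ i, Φ (GroupCStar.of (S.g i)) = sumTmul (G.u i) fun j => GroupCStar.of (S.g j))
    (π : S.Γ →* Q) (q : Q) {i j k : Fin N}
    (h : S.g i * S.g j * S.g k = S.g k * S.g j * S.g i) :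
    (∑ x, ∑ y, ∑ z, if π (S.g x) * π (S.g y) * π (S.g z) = q then
        G.u i x * G.u j y * G.u k z else 0) =
      ∑ x, ∑ y, ∑ z, if π (S.g x) * π (S.g y) * π (S.g z) = q then
        G.u k x * G.u j y * G.u i z else 0 := by
  obtain ⟨E, hE⟩ := exists_coefficient (A := G.C) π q
  have h : Φ (GroupCStar.of (S.g i)) * Φ (GroupCStar.of (S.g j)) * Φ (GroupCStar.of (S.g k)) =
      Φ (GroupCStar.of (S.g k)) * Φ (GroupCStar.of (S.g j)) * Φ (GroupCStar.of (S.g i)) := by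
    simp only [← map_mul, h]
  rw [hΦ, hΦ, hΦ, sumTmul_mul_mul, sumTmul_mul_mul] at h
  have h1 := congrArg E h
  simpa only [← map_mul, map_sum, hE] using h1

end Action

/-- If the reflection group has enough dihedral quotients, then a quantum group which acts
affinely on the cube has cubic coordinates. -/
theorem isCubic_of_actsAffinely [NeZero N] (hG : G.IsQuantumGroup) (hA : G.ActsAffinely S.cube)
    (hS : ∀ e : Fin N → ZMod 7, ∃ π : S.Γ →* DihedralGroup 7,
      ∀ i, π (S.g i) = DihedralGroup.sr (e i)) : IsCubic G.u := by
  obtain ⟨Φ, hΦ⟩ := actsAffinely_cube_iff.1 hA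
  refine hG.isCubic_of_row fun i j k hjk => ?_
  -- A product of two reflections is a rotation by the difference of exponents. With exponents in
  -- `{-1, 0, 1}` the difference `2` is attained only as `1 - (-1)`, so the coefficient at `r 2` is
  -- the single term `u i j * u i k`.
  obtain ⟨π, hπ⟩ := hS fun x => if x = j then -1 else if x = k then 1 else 0
  have h := coefficient_sq hΦ π (DihedralGroup.r 2) (by decide) i
  have hq : ∀ x y, π (S.g x) * π (S.g y) = DihedralGroup.r 2 ↔ x = j ∧ y = k := fun x y => by
    rw [hπ, hπ, DihedralGroup.sr_mul_sr, DihedralGroup.r.injEq]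
    by_cases h1 : x = j <;> by_cases h2 : x = k <;> by_cases h3 : y = j <;> by_cases h4 : y = k <;>
      simp [h1, h2, h3, h4, hjk, hjk.symm] <;> decide
  simpa only [hq, ite_and, Finset.sum_ite_eq', Finset.mem_univ, if_true, Finset.sum_ite_irrel,
    Finset.sum_const_zero] using h

/-- Orthogonal matrices with cubic entries have central squares if they half-commute for triples
with the middle row distinct from the others. -/
theorem commute_sq_of_isCubic (hc : IsCubic G.u)
    (h : ∀ {i j} a b c, j ≠ i → G.u i a * G.u j b * G.u i c = G.u i c * G.u j b * G.u i a)
    (i k a c : Fin N) : G.u i a * G.u i a * G.u k c = G.u k c * (G.u i a * G.u i a) := by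
  by_cases hik : k = i
  · subst hik
    by_cases hac : a = c
    · rw [hac, mul_assoc]
    · rw [mul_assoc, hc.row k hac, mul_zero, ← mul_assoc, hc.row k (Ne.symm hac), zero_mul]
  · have h1 : ∀ d, d ≠ a → G.u i a * G.u i a * G.u k c * (G.u i d * G.u i d) = 0 := fun d hd => by
      calc G.u i a * G.u i a * G.u k c * (G.u i d * G.u i d)
          = G.u i a * (G.u i a * G.u k c * G.u i d) * G.u i d := by noncomm_ring
        _ = G.u i a * G.u i d * G.u k c * G.u i a * G.u i d := by
          rw [h a c d hik]; noncomm_ring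
        _ = 0 := by rw [hc.row i hd.symm]; simp only [zero_mul]
    have h2 : G.u i a * G.u i a * G.u k c =
        G.u i a * G.u i a * G.u k c * (G.u i a * G.u i a) := by
      calc G.u i a * G.u i a * G.u k c
          = G.u i a * G.u i a * G.u k c * ∑ d, G.u i d * G.u i d := by
            rw [G.row, if_pos rfl, mul_one]
        _ = _ := by
            rw [Finset.mul_sum]
            exact Finset.sum_eq_single a (fun d _ hd => h1 d hd) (by simp)
    -- The right side of `h2` becomes self-adjoint up to the self-adjoint middle factor, so the
    -- adjoint identity expresses `u k c * u i a ^ 2` by the same element.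
    have h3 := congrArg star h2
    simp only [star_mul, G.star_u] at h3
    rw [h2, h3]
    noncomm_ring

/-- A quantum group which acts affinely on the half-liberated cube has half-commuting
coordinates. -/
theorem isHalfCommuting_of_actsAffinely [NeZero N] (hG : G.IsQuantumGroup)
    (hA : G.ActsAffinely (halfCubeGroup N).cube) (hc : IsCubic G.u) : IsHalfCommuting G.u := by
  obtain ⟨Φ, hΦ⟩ := actsAffinely_cube_iff.1 hA
  -- Since `g a * g b * g c = g c * g b * g a`, a coefficient cannot separate `a` from `c`. A whole
  -- set `T` of outer indices is therefore isolated at once: exponent `1` on `T`, `-1` at `b`, and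
  -- the alternating sum `3` forces the middle index `b` and outer indices in `T`.
  have hsum : ∀ (T : Finset (Fin N)) (i j k b : Fin N), b ∉ T →
      (∑ x ∈ T, G.u i x) * G.u j b * (∑ x ∈ T, G.u k x) =
        (∑ x ∈ T, G.u k x) * G.u j b * ∑ x ∈ T, G.u i x := fun T i j k b hb => by
    obtain ⟨π, hπ⟩ := exists_halfCubeGroup_dihedral
      fun x : Fin N => if x = b then -1 else if x ∈ T then 1 else 0
    have h := coefficient_half hΦ π (DihedralGroup.sr 3) (halfCubeGroup_half i j k)
    have hq : ∀ x y z, π ((halfCubeGroup N).g x) * π ((halfCubeGroup N).g y) *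
        π ((halfCubeGroup N).g z) = DihedralGroup.sr 3 ↔ x ∈ T ∧ y = b ∧ z ∈ T := fun x y z => by
      rw [hπ, hπ, hπ, DihedralGroup.sr_mul_sr, DihedralGroup.r_mul_sr, DihedralGroup.sr.injEq]
      have hT : ∀ x, x ∈ T → x ≠ b := fun x hx e => hb (e ▸ hx)
      -- The three possible labels of an index (`1` for `T`, `2` for `b`, `0` otherwise) reduce the
      -- claim to a finite check.
      have hd : ∀ p q r : Fin 3, (![0, 1, -1] r - (![0, 1, -1] q - ![0, 1, -1] p) : ZMod 7) = 3 ↔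
          p = 1 ∧ q = 2 ∧ r = 1 := by decide
      have he : ∀ x, ∃ p : Fin 3, (if x = b then -1 else if x ∈ T then 1 else 0 : ZMod 7) =
          ![0, 1, -1] p ∧ (p = 1 ↔ x ∈ T) ∧ (p = 2 ↔ x = b) := fun x => by
        by_cases h1 : x = b
        · exact ⟨2, by simp [h1, hb]⟩
        · by_cases h2 : x ∈ T
          · exact ⟨1, by simp [h1, h2]⟩
          · exact ⟨0, by simp [h1, h2]⟩
      obtain ⟨p, hp, hp1, -⟩ := he x
      obtain ⟨q, hq, -, hq2⟩ := he y
      obtain ⟨r, hr, hr1, -⟩ := he z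
      rw [hp, hq, hr, hd, hp1, hq2, hr1]
    have hF : ∀ i k, (∑ x, ∑ y, ∑ z, if π ((halfCubeGroup N).g x) * π ((halfCubeGroup N).g y) *
        π ((halfCubeGroup N).g z) = DihedralGroup.sr 3 then G.u i x * G.u j y * G.u k z else 0) =
        (∑ x ∈ T, G.u i x) * G.u j b * (∑ x ∈ T, G.u k x) := fun i k => by
      simp only [hq, ite_and, Finset.sum_ite_irrel, Finset.sum_const_zero, Finset.sum_ite_eq',
        Finset.mem_univ, if_true, Finset.sum_ite_mem, Finset.univ_inter, Finset.sum_mul,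
        Finset.mul_sum]
      exact Finset.sum_comm
    rwa [hF, hF] at h
  -- Polarisation: the identities for `{a}` and `{c}` are subtracted from the one for `{a, c}`.
  have hrow : ∀ i j k {a b c}, b ≠ a → b ≠ c →
      G.u i a * G.u j b * G.u k c + G.u i c * G.u j b * G.u k a =
        G.u k c * G.u j b * G.u i a + G.u k a * G.u j b * G.u i c := fun i j k {a b c} hba hbc => by
    have ha := hsum {a} i j k b (by simpa using hba)
    have hc := hsum {c} i j k b (by simpa using hbc)
    simp only [Finset.sum_singleton] at ha hc
    by_cases hac : a = c
    · subst hac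
      rw [ha]
    · have h := hsum {a, c} i j k b (by simp [hba, hbc])
      simp only [Finset.sum_pair hac, add_mul, mul_add, ha, hc] at h
      rw [← sub_eq_zero] at h ⊢
      rw [← h]
      noncomm_ring
  obtain ⟨κ, hκ⟩ := hG.antipode
  -- The antipode image of `hrow`, with rows and columns exchanged; the two crossed monomials now
  -- stand on the opposite sides.
  have hcol : ∀ {i j k} a b c, j ≠ i → j ≠ k →
      G.u i a * G.u j b * G.u k c + G.u k a * G.u j b * G.u i c =
        G.u k c * G.u j b * G.u i a + G.u i c * G.u j b * G.u k a :=
      fun {i j k} a b c hji hjk => by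
    have h := congrArg κ (hrow a b c hji hjk)
    simp only [map_add, map_mul, hκ, ← MulOpposite.op_mul, ← MulOpposite.op_add,
      ← mul_assoc] at h
    have h1 := MulOpposite.op_injective h
    rw [← sub_eq_zero] at h1 ⊢
    rw [← neg_eq_zero, ← h1]
    noncomm_ring
  -- Adding `hrow` and `hcol` cancels the crossed monomials and leaves twice the identity. If the
  -- middle entry shares a column with an outer one, both sides vanish by cubicity.
  have hmid : ∀ {i j k} a b c, j ≠ i → j ≠ k →
      G.u i a * G.u j b * G.u k c = G.u k c * G.u j b * G.u i a := fun {i j k} a b c hji hjk => by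
    by_cases hba : b = a
    · subst hba
      rw [hc.col b hji.symm, mul_assoc, hc.col b hji, zero_mul, mul_zero]
    by_cases hbc : b = c
    · subst hbc
      rw [hc.col b hjk.symm, mul_assoc, hc.col b hjk, zero_mul, mul_zero]
    have h1 := hrow i j k hba hbc
    have h2 := hcol a b c hji hjk
    rw [← sub_eq_zero, ← smul_eq_zero_iff_right (two_ne_zero (α := ℂ)), two_smul]
    rw [← sub_eq_zero] at h1 h2
    have h3 := congrArg₂ (· + ·) h1 h2
    simp only [add_zero] at h3
    rw [← h3]
    noncomm_ring
  -- What remains is a middle entry on the row of an outer one: both sides are zero unless the two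
  -- entries are equal, and then centrality of the square is the claim.
  have hsq := commute_sq_of_isCubic hc fun a b c hij => hmid a b c hij hij
  intro i j k a b c
  by_cases hji : j = i
  · subst hji
    by_cases hba : b = a
    · subst hba
      rw [hsq, mul_assoc]
    · rw [hc.row j (Ne.symm hba), mul_assoc, hc.row j hba, zero_mul, mul_zero]
  by_cases hjk : j = k
  · subst hjk
    by_cases hbc : b = c
    · subst hbc
      rw [hsq, mul_assoc]
    · rw [mul_assoc, hc.row j hbc, hc.row j (Ne.symm hbc), zero_mul, mul_zero]
  exact hmid a b c hji hjk

/-- A quantum group which acts affinely on the cube `ℤ₂^N` has twisted coordinates. -/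
theorem isTwisted_of_actsAffinely [NeZero N] (hG : G.IsQuantumGroup)
    (hA : G.ActsAffinely (cubeGroup N).cube) : IsTwisted G.u := by
  obtain ⟨Φ, hΦ⟩ := actsAffinely_cube_iff.1 hA
  obtain ⟨κ, hκ⟩ := hG.antipode
  -- The two cases exclude each other because `a ≠ b`, so the indicator of the disjunction is a sum
  -- of two indicators.
  have hF : ∀ {a b : Fin N} (_ : a ≠ b) (F : Fin N → Fin N → G.C),
      (∑ x, ∑ y, if (x = a ∧ y = b) ∨ (x = b ∧ y = a) then F x y else 0) = F a b + F b a :=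
      fun {a b} hab F => by
    have h : ∀ x y, (if (x = a ∧ y = b) ∨ (x = b ∧ y = a) then F x y else 0) =
        (if x = a then if y = b then F x y else 0 else 0) +
          if x = b then if y = a then F x y else 0 else 0 := fun x y => by
      by_cases h1 : x = a
      · have h2 : x ≠ b := fun e => hab (h1 ▸ e)
        simp [h1, hab]
      · simp [h1, ite_and]
    simp only [h, Finset.sum_add_distrib, Finset.sum_ite_irrel, Finset.sum_const_zero,
      Finset.sum_ite_eq', Finset.mem_univ, if_true]
  have hq : ∀ {a b : Fin N} (_ : a ≠ b),
      ∃ π : (cubeGroup N).Γ →* Multiplicative (ZMod 2) × Multiplicative (ZMod 2), ∀ x y,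
        π ((cubeGroup N).g x) * π ((cubeGroup N).g y) =
          (Multiplicative.ofAdd 1, Multiplicative.ofAdd 1) ↔
        (x = a ∧ y = b) ∨ (x = b ∧ y = a) := fun {a b} hab => by
    obtain ⟨π, hπ⟩ := exists_cubeGroup_square a b
    refine ⟨π, fun x y => ?_⟩
    rw [hπ, hπ]
    -- Only the truth values of the four equalities matter: exactly one of `x`, `y` must be `a` and
    -- exactly one must be `b`.
    have h : ∀ p q r s : Bool, (((if p then Multiplicative.ofAdd 1 else 1,
        if q then Multiplicative.ofAdd 1 else 1) * (if r then Multiplicative.ofAdd 1 else 1,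
        if s then Multiplicative.ofAdd 1 else 1) : Multiplicative (ZMod 2) × Multiplicative (ZMod 2)) =
        (Multiplicative.ofAdd 1, Multiplicative.ofAdd 1)) ↔ (p ≠ r ∧ q ≠ s) := by decide
    have h1 := h (decide (x = a)) (decide (x = b)) (decide (y = a)) (decide (y = b))
    simp only [decide_eq_true_eq] at h1
    rw [h1]
    by_cases h1 : x = a <;> by_cases h2 : x = b <;> by_cases h3 : y = a <;> by_cases h4 : y = b <;>
      simp [h1, h2, h3, h4] <;> grind
  have hrow : ∀ i {a b}, a ≠ b → G.u i a * G.u i b = -(G.u i b * G.u i a) :=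
      fun i {a b} hab => by
    obtain ⟨π, hπ⟩ := hq hab
    have h := coefficient_sq hΦ π (Multiplicative.ofAdd 1, Multiplicative.ofAdd 1) (by decide) i
    simp only [hπ, hF hab (fun x y => G.u i x * G.u i y)] at h
    exact eq_neg_of_add_eq_zero_left h
  have hcomm : ∀ i j {a b}, a ≠ b → G.u i a * G.u j b + G.u i b * G.u j a =
      G.u j a * G.u i b + G.u j b * G.u i a := fun i j {a b} hab => by
    obtain ⟨π, hπ⟩ := hq hab
    have h := coefficient_comm hΦ π (Multiplicative.ofAdd 1, Multiplicative.ofAdd 1)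
      (cubeGroup_comm i j)
    simpa only [hπ, hF hab (fun x y => G.u i x * G.u j y),
      hF hab (fun x y => G.u j x * G.u i y)] using h
  refine ⟨hrow, fun {i k} j hik => ?_, fun {i k j l} hik hjl => ?_⟩
  · have h := congrArg κ (hrow j hik.symm)
    simp only [map_neg, map_mul, hκ, ← MulOpposite.op_mul, ← MulOpposite.op_neg] at h
    exact MulOpposite.op_injective h
  -- In terms of commutators, `h1` says `[u i j, u k l] = -[u i l, u k j]`, while its antipode
  -- version `h3` says `[u i j, u k l] = [u i l, u k j]`. Their sum gives twice the commutator equal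
  -- to zero.
  · have h1 := hcomm i k hjl
    have h2 := congrArg κ (hcomm l j hik.symm)
    simp only [map_add, map_mul, hκ, ← MulOpposite.op_mul, ← MulOpposite.op_add] at h2
    have h3 := MulOpposite.op_injective h2
    rw [← sub_eq_zero, ← smul_eq_zero_iff_right (two_ne_zero (α := ℂ)), two_smul]
    rw [← sub_eq_zero] at h1 h3
    have h4 := congrArg₂ (· + ·) h1 h3
    simp only [add_zero] at h4
    rw [← h4]
    noncomm_ring

end OrthogonalSubspace

/-! ### Models which separate the quantum groups -/

open scoped ComplexOrder in
/-- Two anticommuting symmetries. -/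
theorem exists_anticommuting_symmetries : ∃ (D : Type) (_ : CStarAlgebra D) (x z : D),
    Nontrivial D ∧ star x = x ∧ star z = z ∧ x * x = 1 ∧ z * z = 1 ∧ x * z = -(z * x) := by
  refine ⟨CStarMatrix (Fin 2) (Fin 2) ℂ, inferInstance, CStarMatrix.ofMatrix !![0, 1; 1, 0],
    CStarMatrix.ofMatrix !![1, 0; 0, -1], inferInstance, ?_, ?_, ?_, ?_, ?_⟩ <;>
  · ext i j
    fin_cases i <;> fin_cases j <;>
      simp [CStarMatrix.mul_apply, CStarMatrix.star_apply]

section Models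

variable {N : ℕ} {D : Type u}

/-- The matrix with entries `d_i` at `(i, i)` and additional entries `s_i` at `(i, σ i)`. -/
def swapMatrix [Ring D] (σ : Equiv.Perm (Fin N)) (d s : Fin N → D) (i j : Fin N) : D :=
  (if i = j then d i else 0) + if σ i = j then s i else 0

variable {σ : Equiv.Perm (Fin N)} {d s : Fin N → D}

/-- Symmetry of the matrix deduces the column relations from the row relations in the two lemmas
below. -/
theorem swapMatrix_symm [Ring D] (hσ : ∀ i, σ (σ i) = i) (hs : ∀ i, s (σ i) = s i)
    (i j : Fin N) : swapMatrix σ d s i j = swapMatrix σ d s j i := by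
  have h : σ i = j ↔ σ j = i := ⟨fun h => by rw [← h, hσ], fun h => by rw [← h, hσ]⟩
  rw [swapMatrix, swapMatrix]
  congr 1
  · by_cases hij : i = j
    · rw [hij]
    · rw [if_neg hij, if_neg (Ne.symm hij)]
  · by_cases hij : σ i = j
    · rw [if_pos hij, if_pos (h.1 hij), ← hij, hs]
    · rw [if_neg hij, if_neg (mt h.2 hij)]

/-- The only off-diagonal inner products that are not trivially zero, those of rows `i` and `σ i`,
equal `d i * s i + s i * d i = 0`. At a fixed point of `σ` the entry is `d i + s i`, and the same
cancellation makes its square `1`. -/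
theorem isOrthogonal_swapMatrix [Ring D] [StarRing D] (hσ : ∀ i, σ (σ i) = i)
    (hs : ∀ i, s (σ i) = s i) (hd : ∀ i, d (σ i) = d i)
    (hds : ∀ i, d i * s i = -(s i * d i)) (h1 : ∀ i, d i * d i + s i * s i = 1)
    (hd' : ∀ i, star (d i) = d i) (hs' : ∀ i, star (s i) = s i) :
    IsOrthogonal (swapMatrix σ d s) := by
  have hr : ∀ i j, ∑ k, swapMatrix σ d s i k * swapMatrix σ d s j k = if i = j then 1 else 0 := by
    intro i j
    simp only [swapMatrix, add_mul, mul_add, ite_mul, mul_ite, zero_mul, mul_zero,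
      Finset.sum_add_distrib, Finset.sum_ite_eq, Finset.mem_univ, if_true]
    have e2 : j = σ i ↔ σ j = i := ⟨fun h => by rw [h, hσ], fun h => by rw [← h, hσ]⟩
    by_cases hij : i = j
    · subst hij
      by_cases h : σ i = i
      · simp only [h, if_true, hds, ← h1 i]
        abel
      · have h' : ¬ i = σ i := fun e => h e.symm
        simp [h, h', h1]
    · have hji : ¬ j = i := fun e => hij e.symm
      by_cases h : σ j = i
      · have h' : j = σ i := e2.2 h
        have hsj : s j = s i := by rw [h', hs]
        have hdj : d j = d i := by rw [h', hd]
        simp [hij, hji, h, ← h', hsj, hdj, hds]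
      · have h' : ¬ j = σ i := mt e2.1 h
        have hne : ¬ σ i = j := fun e => h' e.symm
        have hne' : ¬ i = σ j := fun e => h e.symm
        simp [hij, hne, hne']
  refine ⟨fun i j => ?_, hr, fun i j => ?_⟩
  · rw [swapMatrix, star_add, apply_ite star, apply_ite star, hd', hs', star_zero]
  · simp only [swapMatrix_symm hσ hs _ i, swapMatrix_symm hσ hs _ j, hr]

/-- The entries `d i` at `(i, i)` and `s k` at `(k, σ k)` avoid a common row and column exactly when
`k ≠ i` and `σ k ≠ i`, which is where `hc` asks them to commute. -/
theorem isTwisted_swapMatrix [Ring D] (hσ : ∀ i, σ (σ i) = i) (hs : ∀ i, s (σ i) = s i)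
    (hds : ∀ i, d i * s i = -(s i * d i)) (hdd : ∀ i k, d i * d k = d k * d i)
    (hss : ∀ i k, s i * s k = s k * s i)
    (hc : ∀ i k, i ≠ k → σ k ≠ i → d i * s k = s k * d i) :
    IsTwisted (swapMatrix σ d s) := by
  have hr : ∀ i {j l}, j ≠ l → swapMatrix σ d s i j * swapMatrix σ d s i l =
      -(swapMatrix σ d s i l * swapMatrix σ d s i j) := fun i {j l} hjl => by
    simp only [swapMatrix]
    split_ifs <;> first
      | exact absurd (Eq.trans (Eq.symm ‹i = j›) ‹i = l›) hjl
      | exact absurd (Eq.trans (Eq.symm ‹σ i = j›) ‹σ i = l›) hjl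
      | simp [hds]
  refine ⟨hr, fun {i k} j hik => ?_, fun {i k j l} hik hjl => ?_⟩
  · rw [swapMatrix_symm hσ hs i, swapMatrix_symm hσ hs k, hr j hik]
  · have key : ∀ (i k j l : Fin N), i ≠ k → j ≠ l →
        (if i = j then d i else 0) * (if σ k = l then s k else 0) =
          (if σ k = l then s k else 0) * if i = j then d i else 0 := by
      intro i k j l hik hjl
      by_cases h1 : i = j
      · by_cases h2 : σ k = l
        · rw [if_pos h1, if_pos h2, hc i k hik fun e => hjl (by rw [← h1, ← h2, e])]
        · simp [h2]
      · simp [h1]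
    have e1 : (if i = j then d i else 0) * (if k = l then d k else 0) =
        (if k = l then d k else 0) * if i = j then d i else 0 := by
      split_ifs <;> simp [hdd i k]
    have e2 : (if σ i = j then s i else 0) * (if σ k = l then s k else 0) =
        (if σ k = l then s k else 0) * if σ i = j then s i else 0 := by
      split_ifs <;> simp [hss i k]
    simp only [swapMatrix, add_mul, mul_add, e1, e2, key i k j l hik hjl,
      key k i l j hik.symm hjl.symm]
    abel

end Models

/-! ### Inclusions and non-inclusions between the quantum groups. -/

namespace OrthogonalSubspace

variable {N : ℕ}

theorem halfH_included_freeH : (halfH N).Included (freeH N) :=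
  exists_freeH_hom (isOrthogonal _) isCubic_halfH

theorem not_twistedO_included_halfH (hN : 2 ≤ N) : ¬ (twistedO N).Included (halfH N) := by
  rintro ⟨f, hf⟩
  obtain ⟨D, _, x, z, _, hx, hz, hxx, hzz, hxz⟩ := exists_anticommuting_symmetries
  let p : Fin N := ⟨0, by lia⟩
  let q : Fin N := ⟨1, by lia⟩
  have hpq : p ≠ q := by simp [p, q, Fin.ext_iff]
  -- A block with `3/5 x` on the diagonal and `4/5 z` off it, completed by the identity; `(3/5,
  -- 4/5)` is a rational point of the unit circle with nonzero coordinates.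
  let d : Fin N → D := fun i => if i = p ∨ i = q then (3 / 5 : ℂ) • x else 1
  let s : Fin N → D := fun i => if i = p ∨ i = q then (4 / 5 : ℂ) • z else 0
  let σ := Equiv.swap p q
  have hσ : ∀ i, σ (σ i) = i := Equiv.swap_apply_self p q
  have hmem : ∀ i, (σ i = p ∨ σ i = q) = (i = p ∨ i = q) := fun i => by
    rw [Equiv.swap_apply_eq_iff, Equiv.swap_apply_eq_iff, Equiv.swap_apply_left,
      Equiv.swap_apply_right, or_comm]
  have hd : ∀ i, d (σ i) = d i := fun i => by simp only [d, hmem]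
  have hs : ∀ i, s (σ i) = s i := fun i => by simp only [s, hmem]
  have hds : ∀ i, d i * s i = -(s i * d i) := fun i => by
    by_cases h : i = p ∨ i = q
    · simp only [d, s, if_pos h, smul_mul_smul_comm, hxz, smul_neg]
      rw [mul_comm (3 / 5 : ℂ)]
    · simp [s, h]
  have h1 : ∀ i, d i * d i + s i * s i = 1 := fun i => by
    by_cases h : i = p ∨ i = q
    · simp only [d, s, if_pos h, smul_mul_smul_comm, hxx, hzz, ← add_smul]
      norm_num
    · simp [d, s, h]
  have h3 : star (3 / 5 : ℂ) = 3 / 5 := by simp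
  have h4 : star (4 / 5 : ℂ) = 4 / 5 := by simp
  have hd' : ∀ i, star (d i) = d i := fun i => by
    simp only [d, apply_ite star, star_smul, h3, hx, star_one]
  have hs' : ∀ i, star (s i) = s i := fun i => by
    simp only [s, apply_ite star, star_smul, h4, hz, star_zero]
  have hdd : ∀ i k, d i * d k = d k * d i := fun i k => by
    simp only [d]
    split_ifs <;> simp
  have hss : ∀ i k, s i * s k = s k * s i := fun i k => by
    simp only [s]
    split_ifs <;> simp
  have hc : ∀ i k, i ≠ k → σ k ≠ i → d i * s k = s k * d i := fun i k hik hk => by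
    by_cases h : k = p ∨ k = q
    · have hi : ¬(i = p ∨ i = q) := by
        rcases h with rfl | rfl
        · exact not_or.2 ⟨hik, fun e => hk (by rw [e]; exact Equiv.swap_apply_left p q)⟩
        · exact not_or.2 ⟨fun e => hk (by rw [e]; exact Equiv.swap_apply_right p q), hik⟩
      simp [d, hi]
    · simp [s, h]
  obtain ⟨ψ, hψ⟩ := exists_twistedO_hom (isOrthogonal_swapMatrix hσ hs hd hds h1 hd' hs')
    (isTwisted_swapMatrix hσ hs hds hdd hss hc)
  -- An inclusion would carry the cubic relation on row `p` to this model, forcing `x * z = 0`,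
  -- although `x * z` is invertible.
  have h := congrArg (fun t => ψ (f t)) (isCubic_halfH.row p hpq)
  simp only [map_mul, hf, hψ, map_zero] at h
  have hp : swapMatrix σ d s p p = (3 / 5 : ℂ) • x := by
    simp [swapMatrix, σ, d, hpq.symm]
  have hq : swapMatrix σ d s p q = (4 / 5 : ℂ) • z := by
    simp [swapMatrix, σ, s, hpq]
  rw [hp, hq, smul_mul_smul_comm, smul_eq_zero_iff_right (by norm_num)] at h
  have h5 : x * z * (z * x) = 1 := by
    rw [mul_assoc, ← mul_assoc z, hzz, one_mul, hxx]
  rw [h, zero_mul] at h5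
  exact zero_ne_one h5

theorem not_halfH_included_twistedO (hN : 2 ≤ N) : ¬ (halfH N).Included (twistedO N) := by
  rintro ⟨f, hf⟩
  obtain ⟨D, _, x, z, _, hx, hz, hxx, hzz, hxz⟩ := exists_anticommuting_symmetries
  let p : Fin N := ⟨0, by lia⟩
  let q : Fin N := ⟨1, by lia⟩
  have hpq : p ≠ q := by simp [p, q, Fin.ext_iff]
  -- A diagonal matrix of symmetries is cubic. With only two distinct values it also half-commutes:
  -- if the outer factors differ, the middle one cancels against one of them. Its entries at `p` and
  -- `q` do not commute, contrary to the twisted relations.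
  let d : Fin N → D := fun i => if i = p then x else z
  let v : Fin N → Fin N → D := fun i j => if i = j then d i else 0
  have hdd : ∀ i, d i * d i = 1 := fun i => by
    simp only [d]
    split_ifs <;> assumption
  have hd' : ∀ i, star (d i) = d i := fun i => by
    simp only [d]
    split_ifs <;> assumption
  have hv : IsOrthogonal v := by
    refine ⟨fun i j => by simp only [v, apply_ite star, hd', star_zero], fun i j => ?_,
      fun i j => ?_⟩
    · by_cases hij : i = j
      · simp [v, hij, hdd]
      · simp [v, hij]
    · by_cases hij : i = j
      · simp [v, hij, hdd]
      · simp [v, hij, Ne.symm hij]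
  have hc : IsCubic v := by
    refine ⟨fun i j l hjl => ?_, fun {i k} j hik => ?_⟩
    · by_cases hij : i = j
      · have hil : ¬ i = l := fun e => hjl (hij.symm.trans e)
        simp [v, hil]
      · simp [v, hij]
    · by_cases hij : i = j
      · have hkj : ¬ k = j := fun e => hik (hij.trans e.symm)
        simp [v, hkj]
      · simp [v, hij]
  have hxx' : ∀ t, x * (x * t) = t := fun t => by rw [← mul_assoc, hxx, one_mul]
  have hzz' : ∀ t, z * (z * t) = t := fun t => by rw [← mul_assoc, hzz, one_mul]
  have hval : ∀ i j, v i j = 0 ∨ v i j = x ∨ v i j = z := fun i j => by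
    simp only [v, d]
    split_ifs <;> simp
  have hh : IsHalfCommuting v := fun i j k a b c => by
    rcases hval i a with h1 | h1 | h1 <;> rcases hval j b with h2 | h2 | h2 <;>
      rcases hval k c with h3 | h3 | h3 <;>
      simp [h1, h2, h3, mul_assoc, hxx, hzz, hxx', hzz']
  obtain ⟨ψ, hψ⟩ := exists_halfH_hom hv hc hh
  have h := congrArg (fun t => ψ (f t)) (isTwisted_twistedO.comm hpq hpq)
  have hp : v p p = x := by simp [v, d]
  have hq : v q q = z := by simp [v, d, hpq.symm]
  simp only [map_mul, hf, hψ, hp, hq] at h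
  rw [hxz, neg_eq_iff_add_eq_zero, ← two_smul ℂ, smul_eq_zero_iff_right two_ne_zero] at h
  have h5 : z * x * (x * z) = 1 := by
    rw [mul_assoc, hxx', hzz]
  rw [h, zero_mul] at h5
  exact zero_ne_one h5

/-! ### The quantum affine isometry groups of the cubes -/

variable [NeZero N]

theorem isQuantumIsometryGroup_twistedO :
    IsQuantumIsometryGroup.{u} (cubeGroup N).cube (twistedO N) :=
  ⟨isQuantumGroup_twistedO N, actsAffinely_twistedO, fun G hG hA =>
    exists_twistedO_hom G.isOrthogonal (isTwisted_of_actsAffinely hG hA)⟩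

theorem isQuantumIsometryGroup_halfH :
    IsQuantumIsometryGroup.{u} (halfCubeGroup N).cube (halfH N) :=
  ⟨isQuantumGroup_halfH N, actsAffinely_halfH, fun G hG hA =>
    have hc := isCubic_of_actsAffinely hG hA exists_halfCubeGroup_dihedral
    exists_halfH_hom G.isOrthogonal hc (isHalfCommuting_of_actsAffinely hG hA hc)⟩

theorem isQuantumIsometryGroup_freeH :
    IsQuantumIsometryGroup.{u} (freeCubeGroup N).cube (freeH N) :=
  ⟨isQuantumGroup_freeH N, actsAffinely_freeH, fun G hG hA =>
    exists_freeH_hom G.isOrthogonal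
      (isCubic_of_actsAffinely hG hA exists_freeCubeGroup_dihedral)⟩

end OrthogonalSubspace

/-! ### Inclusions between the cubes. -/

theorem cube_included_halfCube (N : ℕ) [NeZero N] :
    (cubeGroup N).cube.Included (halfCubeGroup N).cube := by
  obtain ⟨ρ, hρ⟩ := exists_halfCubeGroup_hom (cubeGroup N).g (cubeGroup N).sq fun i j k => by
    rw [cubeGroup_comm i j, mul_assoc, cubeGroup_comm i k, ← mul_assoc, cubeGroup_comm j k]
  exact ReflectionGroup.cube_included_of_hom _ _ ρ hρ

theorem halfCube_included_freeCube (N : ℕ) [NeZero N] :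
    (halfCubeGroup N).cube.Included (freeCubeGroup N).cube := by
  obtain ⟨ρ, hρ⟩ := exists_freeCubeGroup_hom (halfCubeGroup N).g (halfCubeGroup N).sq
  exact ReflectionGroup.cube_included_of_hom _ _ ρ hρ

end NCCube

theorem theorem3p7 (N : ℕ) [NeZero N] :
    -- the quantum affine isometry groups of the three cubes
    NCCube.IsQuantumIsometryGroup.{u} (NCCube.cubeGroup N).cube
      (NCCube.OrthogonalSubspace.twistedO N) ∧
    NCCube.IsQuantumIsometryGroup.{u} (NCCube.halfCubeGroup N).cube
      (NCCube.OrthogonalSubspace.halfH N) ∧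
    NCCube.IsQuantumIsometryGroup.{u} (NCCube.freeCubeGroup N).cube
      (NCCube.OrthogonalSubspace.freeH N) ∧
    -- the inclusions between the cubes
    (NCCube.cubeGroup N).cube.Included (NCCube.halfCubeGroup N).cube ∧
    (NCCube.halfCubeGroup N).cube.Included (NCCube.freeCubeGroup N).cube ∧
    -- the inclusion between the last two quantum groups, and no inclusion between the first two
    (NCCube.OrthogonalSubspace.halfH N).Included (NCCube.OrthogonalSubspace.freeH N) ∧
    (2 ≤ N →
      ¬ (NCCube.OrthogonalSubspace.twistedO N).Included (NCCube.OrthogonalSubspace.halfH N) ∧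
      ¬ (NCCube.OrthogonalSubspace.halfH N).Included (NCCube.OrthogonalSubspace.twistedO N)) :=
  ⟨NCCube.OrthogonalSubspace.isQuantumIsometryGroup_twistedO,
    NCCube.OrthogonalSubspace.isQuantumIsometryGroup_halfH,
    NCCube.OrthogonalSubspace.isQuantumIsometryGroup_freeH,
    NCCube.cube_included_halfCube N, NCCube.halfCube_included_freeCube N,
    NCCube.OrthogonalSubspace.halfH_included_freeH,
    fun hN => ⟨NCCube.OrthogonalSubspace.not_twistedO_included_halfH hN,
      NCCube.OrthogonalSubspace.not_halfH_included_twistedO hN⟩⟩
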